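/- Let $A$ be a finite alphabet. A language $L$ on $A$ is a set of finite words on $A$ which contains the empty word, such that every $v\in L$ has extensions $av\in L$ and $vb\in L$ with letters $a,b\in A$, and such that deleting the first or the last letter of a nonempty word of $L$ gives a word of $L$. We assume that every letter of $A$ belongs to $L$ (as a word of length one). Let $F\subset A$ be a possibly empty set of letters. $L$ is recurrent if for each $v\in L$ there is a nonempty $w\in L$ such that $vw$ belongs to $L$ and ends with $v$. A word $w\in L$ is bispecial if there are at least two letters $x$ with $xw\in L$ and at least two letters $x$ with $wx\in L$. $L$ satisfies an $F$-flipped order condition if there are two total orders $<_A$ and $<_D$ on $A$ such that for each bispecial word $w$, whenever $awc$ and $bwd$ are in $L$ with letters $a\ne b$ and $c\neq d$, one has $a<_A b$ if and only if $c<_{D,w}d$, where $<_{D,w}$ is $<_D$ if the number of occurrences in $w$ of letters of $F$ is even, and the reverse of $<_D$ if it is odd. A generalized $F$-flipped interval exchange transformation is a map $T$ defined on a disjoint union of nonempty open intervals $I_e$, $e\in A$ (which are part of the data), whose closures have union $[0,1]$, continuous on each $I_e$, strictly increasing on $I_e$ if $e\notin F$ and strictly decreasing on $I_e$ if $e\in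 F$, and such that the $TI_e$ are disjoint open intervals whose closures have union $[0,1]$. It is standard if on each $I_e$ it is affine of slope $\pm1$. Its language is the set of all finite factors of its trajectories, a trajectory being a sequence $(x_n)_{n\in\mathbb Z}$ in $A^{\mathbb Z}$ such that for some point $y$ all $T^ny$, $n\in\mathbb Z$, are defined and $T^ny\in I_{x_n}$. A wandering interval of $T$ is an interval $J\subset[0,1]$ with more than one point such that for all $n>0$ and all $y\in J$ at which every $T^k$, $k\in\mathbb N$, is defined, $T^ny\notin J$. **Theorem.** The following are equivalent: (i) $L$ satisfies an $F$-flipped order condition and is recurrent; (ii) $L$ is the language of a standard $F$-flipped interval exchange transformation; (iii) $L$ is the language of a generalized $F$-flipped interval exchange transformation without wandering intervals. -/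

import Mathlib

/-! ### Languages -/

/-- `L` is a factorial extendable language: it contains the empty word, every word of `L`
extends in `L` by one letter on the left and by one letter on the right, and removing the first or
the last letter of a word of `L` leaves a word of `L`.  The set `L_n` of the words of length `n`
is `{w ∈ L | w.length = n}`. -/
structure IsFactorialExtendable {A : Type*} (L : Language A) : Prop where
  nil_mem : [] ∈ L
  extend_left : ∀ v ∈ L, ∃ a : A, a :: v ∈ L
  extend_right : ∀ v ∈ L, ∃ b : A, v ++ [b] ∈ L
  tail_mem : ∀ (a : A) (u : List A), a :: u ∈ L → u ∈ L
  init_mem : ∀ (u : List A) (b : A), u ++ [b] ∈ L → u ∈ L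

/-- Every `v ∈ L` returns: there is a nonempty `w ∈ L` such that `vw` is in `L` and ends
with `v`. -/
def IsRecurrentLanguage {A : Type*} (L : Language A) : Prop :=
  ∀ v ∈ L, ∃ w ∈ L, w ≠ [] ∧ v ++ w ∈ L ∧ v <:+ v ++ w

/-- The arrival set of `w`: the letters `x` such that `xw` is in `L`. -/
def arrivalSet {A : Type*} (L : Language A) (w : List A) : Set A := {x | x :: w ∈ L}

/-- The departure set of `w`: the letters `x` such that `wx` is in `L`. -/
def departureSet {A : Type*} (L : Language A) (w : List A) : Set A := {x | w ++ [x] ∈ L}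

/-- `w ∈ L` is bispecial: its arrival set and its departure set both have more than one element. -/
def IsBispecial {A : Type*} (L : Language A) (w : List A) : Prop :=
  w ∈ L ∧ (arrivalSet L w).Nontrivial ∧ (departureSet L w).Nontrivial

/-- The requirement of an order condition at the word `w`, for two strict orders on the letters:
whenever `awc` and `bwd` are in `L` with `a ≠ b` and `c ≠ d`, then `a < b` for the first order
if and only if `c < d` for the second one. -/
def OrderConditionAt {A : Type*} (L : Language A) (w : List A)
    (ltA ltD : A → A → Prop) : Prop :=
  ∀ a b c d : A, a :: (w ++ [c]) ∈ L → b :: (w ++ [d]) ∈ L → a ≠ b → c ≠ d →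
    (ltA a b ↔ ltD c d)

/-- The `F`-flipped order condition: there are two total orders `<_A` and `<_D` on the letters
such that each bispecial word `w` satisfies the order requirement for `<_A` and `<_D` if the number
of occurrences in `w` of letters of `F` is even, for `<_A` and the reverse of `<_D` if it is odd. -/
def FlippedOrderCondition {A : Type*} [DecidableEq A] (F : Finset A) (L : Language A) : Prop :=
  ∃ oA oD : LinearOrder A, ∀ w : List A, IsBispecial L w →
    (Even (w.countP (· ∈ F)) → OrderConditionAt L w oA.lt oD.lt) ∧
    (Odd (w.countP (· ∈ F)) → OrderConditionAt L w oA.lt (fun c d => oD.lt d c))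

/-! ### Interval exchange transformations -/

/-- A generalized `F`-flipped interval exchange transformation, given together with its defining
intervals `I_e = (left e, right e)`, which are nonempty.  The map is only meaningful on the union
of the `I_e`; the values of `toFun` elsewhere are never used. -/
structure FlippedIET (A : Type*) (F : Finset A) where
  /-- left endpoint of the defining interval -/
  left : A → ℝ
  /-- right endpoint of the defining interval -/
  right : A → ℝ
  /-- the transformation -/
  toFun : ℝ → ℝ
  left_lt_right : ∀ e, left e < right e
  disjoint_intervals : ∀ e f, e ≠ f →
    Disjoint (Set.Ioo (left e) (right e)) (Set.Ioo (left f) (right f))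
  closure_intervals : ⋃ e, closure (Set.Ioo (left e) (right e)) = Set.Icc 0 1
  continuous_on : ∀ e, ContinuousOn toFun (Set.Ioo (left e) (right e))
  increasing : ∀ e, e ∉ F → StrictMonoOn toFun (Set.Ioo (left e) (right e))
  decreasing : ∀ e, e ∈ F → StrictAntiOn toFun (Set.Ioo (left e) (right e))
  image_interval : ∀ e, ∃ c d : ℝ, c < d ∧ toFun '' Set.Ioo (left e) (right e) = Set.Ioo c d
  disjoint_images : ∀ e f, e ≠ f →
    Disjoint (toFun '' Set.Ioo (left e) (right e)) (toFun '' Set.Ioo (left f) (right f))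
  closure_images : ⋃ e, closure (toFun '' Set.Ioo (left e) (right e)) = Set.Icc 0 1

namespace FlippedIET

/-- The defining interval `I_e`. -/
def interval {A : Type*} {F : Finset A} (T : FlippedIET A F) (e : A) : Set ℝ :=
  Set.Ioo (T.left e) (T.right e)

/-- The domain of the transformation. -/
def domain {A : Type*} {F : Finset A} (T : FlippedIET A F) : Set ℝ := ⋃ e, T.interval e

/-- `T` is standard: on each defining interval it is affine of slope `1` or `-1`. -/
def IsStandard {A : Type*} {F : Finset A} (T : FlippedIET A F) : Prop :=
  ∀ e, ∃ s t : ℝ, (s = 1 ∨ s = -1) ∧ ∀ x ∈ T.interval e, T.toFun x = s * x + t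

/-- The set of the points at which all iterates `T^n`, `n ∈ ℕ`, are defined. -/
def forwardDomain {A : Type*} {F : Finset A} (T : FlippedIET A F) : Set ℝ :=
  {x | ∀ n : ℕ, T.toFun^[n] x ∈ T.domain}

/-- `J` is a wandering interval: a subinterval of `[0,1]`, with more than one point, such that
`T^n J` is disjoint from `J` for all `n > 0`, where `T^n J` is formed with the points of `J`
at which all the iterates are defined. -/
def IsWanderingInterval {A : Type*} {F : Finset A} (T : FlippedIET A F) (J : Set ℝ) : Prop :=
  J.OrdConnected ∧ J.Nontrivial ∧ J ⊆ Set.Icc 0 1 ∧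
    ∀ n : ℕ, 0 < n → Disjoint (T.toFun^[n] '' (J ∩ T.forwardDomain)) J

/-- `x` is the trajectory of a point `y 0`: the `y n = T^n (y 0)`, `n ∈ ℤ`, are all defined and
`y n` lies in the defining interval of the letter `x n`.  (`T` is injective on its domain, so
`y` is determined by `y 0`.) -/
def IsTrajectory {A : Type*} {F : Finset A} (T : FlippedIET A F) (x : ℤ → A) : Prop :=
  ∃ y : ℤ → ℝ, ∀ n : ℤ, y n ∈ T.interval (x n) ∧ y (n + 1) = T.toFun (y n)

/-- The natural coding `L(T)`: the set of all factors `x_k x_{k+1} ⋯ x_{k+m-1}` (`k ∈ ℤ`, `m ∈ ℕ`)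
of the trajectories `x` of `T`. -/
def naturalCoding {A : Type*} {F : Finset A} (T : FlippedIET A F) : Language A :=
  {w | ∃ x : ℤ → A, T.IsTrajectory x ∧
    ∃ (k : ℤ) (m : ℕ), w = (List.range m).map (fun i : ℕ => x (k + (i : ℤ)))}

end FlippedIET

/-! The implication from interval exchanges to the order condition is read off the intervals: the
points following a given word form an open set, on which the iterates are monotone, and two points
in distinct intervals are ordered as these intervals; if there is no wandering interval, a point of
this open set returns to it, so the language is recurrent. A standard interval exchange preserves
the Lebesgue measure, so it has no wandering interval by the Poincaré recurrence theorem.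

The converse rests on invariant weights on words, that is on shift-invariant probability measures.
Given such a weight `μ` supported by a language with the order condition, the words of length `n`
are placed side by side in `[0,1]`, in the flipped lexicographic order defined by `<_D`, as
intervals of lengths `μ w`. The order condition implies that the isometry attached to a letter
`a`, which sends the interval of `a` onto its interval for the order `<_A`, carries the interval of
`a w` into the interval of `w` (`exists_slide_eq`). Hence a weight positive on the whole language
realizes it by a standard interval exchange (`exists_isStandard_of_weight`).

It remains to find, for each word `v` of a recurrent language with the order condition, an invariant
weight positive at `v`. By recurrence `v` starts a sequence `y` each prefix of which occurs again;
let `μ` be a limit of the frequencies of the words in `y`, and suppose that `μ v = 0`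
(`pos_window_of_returning`). Then each tail of `y` occupies a single point of `[0,1]`, and these
points follow the isometries of the letters. After each occurrence of `v` they must meet an endpoint
of the interval of a letter, otherwise `v` would be a word of positive weight; as the motion is
deterministic away from these finitely many endpoints, the points are finitely many
(`finite_range_positions`). All words of positive weight have intervals meeting this finite set,
which forces the sequences they form to be eventually periodic (`exists_period`). Finally the order
condition forces a periodic sequence with all its factors in `y` to contain every prefix of `y`, `v`
included (`not_periodic_of_returning`), although all its factors have positive weight. -/

open Set Filter Topology

namespace FlippedIET

/-! ### Itineraries in an interval exchange -/

section Basics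

variable {A : Type*} {F : Finset A} (T : FlippedIET A F)

lemma isOpen_domain : IsOpen T.domain := isOpen_iUnion fun _ => isOpen_Ioo

lemma interval_subset_domain (e : A) : T.interval e ⊆ T.domain := subset_iUnion T.interval e

lemma domain_subset_Icc : T.domain ⊆ Icc 0 1 := by
  rw [← T.closure_intervals]
  exact iUnion_mono fun e => subset_closure

lemma image_domain_subset_Icc : T.toFun '' T.domain ⊆ Icc 0 1 := by
  rw [← T.closure_images, domain, image_iUnion]
  exact iUnion_mono fun e => subset_closure

lemma injOn_interval (e : A) : InjOn T.toFun (T.interval e) := by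
  by_cases he : e ∈ F
  · exact (T.decreasing e he).injOn
  · exact (T.increasing e he).injOn

lemma eq_of_mem_interval {e f : A} {x : ℝ} (he : x ∈ T.interval e) (hf : x ∈ T.interval f) :
    e = f := by
  by_contra h
  exact disjoint_left.1 (T.disjoint_intervals e f h) he hf

lemma injOn_domain : InjOn T.toFun T.domain := by
  intro x hx y hy hxy
  obtain ⟨e, he⟩ := mem_iUnion.1 hx
  obtain ⟨f, hf⟩ := mem_iUnion.1 hy
  by_cases h : e = f
  · subst h
    exact T.injOn_interval e he hf hxy
  · exact absurd (mem_image_of_mem T.toFun hf)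
      (disjoint_left.1 (T.disjoint_images e f h) (hxy ▸ mem_image_of_mem T.toFun he))

lemma countable_Icc_diff_domain [Finite A] : (Icc 0 1 \ T.domain).Countable := by
  refine ((finite_range T.left).union (finite_range T.right)).countable.mono ?_
  rintro x ⟨hx, hxd⟩
  rw [← T.closure_intervals] at hx
  obtain ⟨e, he⟩ := mem_iUnion.1 hx
  rw [closure_Ioo (T.left_lt_right e).ne] at he
  by_contra hne
  simp only [mem_union, mem_range, not_or, not_exists] at hne
  exact hxd (T.interval_subset_domain e
    ⟨lt_of_le_of_ne he.1 (hne.1 e), lt_of_le_of_ne he.2 fun h => hne.2 e h.symm⟩)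

lemma countable_Icc_diff_image [Finite A] : (Icc 0 1 \ T.toFun '' T.domain).Countable := by
  choose c d hcd hT using T.image_interval
  refine ((finite_range c).union (finite_range d)).countable.mono ?_
  rintro x ⟨hx, hxd⟩
  rw [← T.closure_images] at hx
  obtain ⟨e, he⟩ := mem_iUnion.1 hx
  rw [hT e, closure_Ioo (hcd e).ne] at he
  by_contra hne
  simp only [mem_union, mem_range, not_or, not_exists] at hne
  have hx' : x ∈ Ioo (c e) (d e) :=
    ⟨lt_of_le_of_ne he.1 (hne.1 e), lt_of_le_of_ne he.2 fun h => hne.2 e h.symm⟩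
  rw [← hT e] at hx'
  exact hxd (image_mono (T.interval_subset_domain e) hx')

/-- All but countably many points of `[0,1]` form a set on which the transformation is a
permutation: one removes the full orbits of the finitely many points of `[0,1]` at which the
transformation or its inverse is undefined. -/
lemma exists_bijOn [Finite A] :
    ∃ G ⊆ T.domain, (Icc 0 1 \ G).Countable ∧ BijOn T.toFun G G := by
  let Z : ℕ → Set ℝ := fun n => Nat.rec ((Icc 0 1 \ T.domain) ∪ (Icc 0 1 \ T.toFun '' T.domain))
    (fun _ s => T.toFun '' s ∪ (T.domain ∩ T.toFun ⁻¹' s)) n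
  have hZ : ∀ n, (Z n).Countable := by
    intro n
    induction n with
    | zero => exact T.countable_Icc_diff_domain.union T.countable_Icc_diff_image
    | succ n ih =>
      refine (ih.image T.toFun).union ?_
      exact MapsTo.countable_of_injOn (f := T.toFun) (t := Z n) (fun x hx => hx.2)
        (T.injOn_domain.mono inter_subset_left) ih
  have hdom : Icc 0 1 \ ⋃ n, Z n ⊆ T.domain := by
    rintro x ⟨hx, hxZ⟩
    by_contra h
    exact hxZ (mem_iUnion.2 ⟨0, Or.inl ⟨hx, h⟩⟩)
  refine ⟨Icc 0 1 \ ⋃ n, Z n, hdom, ?_, ?_, T.injOn_domain.mono hdom, ?_⟩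
  · exact (countable_iUnion hZ).mono fun x hx => by
      by_contra h
      exact hx.2 ⟨hx.1, h⟩
  · intro x hx
    refine ⟨T.image_domain_subset_Icc (mem_image_of_mem _ (hdom hx)), fun h => hx.2 ?_⟩
    obtain ⟨n, hn⟩ := mem_iUnion.1 h
    exact mem_iUnion.2 ⟨n + 1, Or.inr ⟨hdom hx, hn⟩⟩
  · intro z hz
    have hz' : z ∈ T.toFun '' T.domain := by
      by_contra h
      exact hz.2 (mem_iUnion.2 ⟨0, Or.inr ⟨hz.1, h⟩⟩)
    obtain ⟨x, hx, rfl⟩ := hz'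
    refine ⟨x, ⟨T.domain_subset_Icc hx, fun h => hz.2 ?_⟩, rfl⟩
    obtain ⟨n, hn⟩ := mem_iUnion.1 h
    exact mem_iUnion.2 ⟨n + 1, Or.inl (mem_image_of_mem _ hn)⟩

/-- The orbit of `y` visits successively the defining intervals of the letters of the word. -/
def Follows : List A → ℝ → Prop
  | [], _ => True
  | a :: w, y => y ∈ T.interval a ∧ Follows w (T.toFun y)

lemma Follows.eq_of_length_eq {T : FlippedIET A F} {u v : List A} {y : ℝ} (hu : T.Follows u y)
    (hv : T.Follows v y) (h : u.length = v.length) : u = v := by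
  induction u generalizing v y with
  | nil => exact (List.length_eq_zero_iff.1 h.symm).symm
  | cons a u ih =>
    match v with
    | [] => simp at h
    | b :: v =>
      rw [T.eq_of_mem_interval hu.1 hv.1, ih hu.2 hv.2 (by simpa using h)]

lemma follows_append {u v : List A} {y : ℝ} :
    T.Follows (u ++ v) y ↔ T.Follows u y ∧ T.Follows v (T.toFun^[u.length] y) := by
  induction u generalizing y with
  | nil => simp [Follows]
  | cons a u ih => simp [Follows, ih, and_assoc]

lemma isOpen_follows (w : List A) : IsOpen {y | T.Follows w y} := by
  induction w with
  | nil => simp [Follows]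
  | cons a w ih => exact (T.continuous_on a).isOpen_inter_preimage isOpen_Ioo ih

lemma follows_map_range {x : ℕ → A} {y : ℝ} {m : ℕ}
    (h : ∀ i < m, T.toFun^[i] y ∈ T.interval (x i)) : T.Follows ((List.range m).map x) y := by
  induction m generalizing x y with
  | zero => trivial
  | succ m ih =>
    rw [List.range_succ_eq_map, List.map_cons, List.map_map]
    exact ⟨h 0 (by omega), ih fun i hi => h (i + 1) (by omega)⟩

/-- The natural coding consists of the itineraries of arbitrary points: the points following a
given word form an open set, so if there are any, one of them has a two-sided orbit. -/
lemma mem_naturalCoding_iff [Finite A] {w : List A} :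
    w ∈ T.naturalCoding ↔ ∃ y ∈ T.domain, T.Follows w y := by
  constructor
  · rintro ⟨x, ⟨y, hy⟩, k, m, rfl⟩
    have hit : ∀ i : ℕ, T.toFun^[i] (y k) = y (k + i) := by
      intro i
      induction i with
      | zero => simp
      | succ i ih =>
        rw [Function.iterate_succ_apply', ih, ← (hy _).2]
        push_cast
        ring_nf
    exact ⟨y k, T.interval_subset_domain _ (hy k).1,
      T.follows_map_range fun i _ => by rw [hit]; exact (hy _).1⟩
  · rintro ⟨y₀, hy₀, hw⟩
    obtain ⟨G, hGd, hGc, hG⟩ := T.exists_bijOn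
    obtain ⟨y₁, hy₁, hyG⟩ := (hGc.dense_compl ℝ).inter_open_nonempty _
      (T.isOpen_domain.inter (T.isOpen_follows w)) ⟨y₀, hy₀, hw⟩
    have hy₁G : y₁ ∈ G := by
      by_contra h
      exact hyG ⟨T.domain_subset_Icc hy₁.1, h⟩
    let e : Equiv.Perm G := hG.equiv
    let y : ℤ → ℝ := fun n => ((e ^ n) ⟨y₁, hy₁G⟩ : G)
    have hstep : ∀ n, y (n + 1) = T.toFun (y n) := by
      intro n
      change (((e ^ (n + 1)) ⟨y₁, hy₁G⟩ : G) : ℝ) = _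
      rw [add_comm, zpow_one_add]
      rfl
    have hdom : ∀ n, y n ∈ T.domain := fun n => hGd (Subtype.coe_prop _)
    choose x hx using fun n => mem_iUnion.1 (hdom n)
    refine ⟨x, ⟨y, fun n => ⟨hx n, hstep n⟩⟩, 0, w.length, ?_⟩
    have hit : ∀ i : ℕ, T.toFun^[i] y₁ = y i := by
      intro i
      induction i with
      | zero => simp [y]
      | succ i ih =>
        rw [Function.iterate_succ_apply', ih, ← hstep]
        push_cast
        rfl
    refine hy₁.2.eq_of_length_eq (T.follows_map_range fun i _ => ?_) (by simp)
    rw [hit, zero_add]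
    exact hx i

end Basics

/-! ### The order condition of a natural coding -/

section Order

variable {A : Type*} {F : Finset A} (T : FlippedIET A F)

lemma left_injective : Function.Injective T.left := by
  intro e f h
  by_contra hne
  have h1 := T.left_lt_right e
  have h2 := T.left_lt_right f
  have hd := T.disjoint_intervals e f hne
  rw [Set.disjoint_left] at hd
  obtain ⟨x, hx1, hx2⟩ := exists_between (lt_min h1 (h ▸ h2))
  rw [lt_min_iff] at hx2
  exact hd ⟨hx1, hx2.1⟩ ⟨h ▸ hx1, hx2.2⟩

/-- Points of two disjoint open intervals are ordered as the left endpoints. -/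
lemma _root_.lt_iff_left_lt_of_disjoint_Ioo {c d c' d' x x' : ℝ}
    (h : Disjoint (Ioo c d) (Ioo c' d')) (hx : x ∈ Ioo c d) (hx' : x' ∈ Ioo c' d') :
    c < c' ↔ x < x' := by
  rw [Set.disjoint_left] at h
  constructor
  · intro hc
    by_contra hlt
    exact h hx ⟨hx'.1.trans_le (not_lt.1 hlt), by
      by_contra hd
      exact h ⟨hc.trans hx'.1, hx'.2.trans_le ((not_lt.1 hd).trans hx.2.le)⟩ hx'⟩
  · intro hlt
    by_contra hc
    exact h ⟨hx.1, hx.2⟩ ⟨(not_lt.1 hc).trans_lt hx.1, hlt.trans hx'.2⟩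

lemma Follows.lt_iff [DecidableEq A] {T : FlippedIET A F} {w : List A} {x y : ℝ}
    (hx : T.Follows w x) (hy : T.Follows w y) :
    (Even (w.countP (· ∈ F)) → (x < y ↔ T.toFun^[w.length] x < T.toFun^[w.length] y)) ∧
    (Odd (w.countP (· ∈ F)) → (x < y ↔ T.toFun^[w.length] y < T.toFun^[w.length] x)) := by
  induction w generalizing x y with
  | nil => simp
  | cons a w ih =>
    have h1 := ih hx.2 hy.2
    have h2 := ih hy.2 hx.2
    by_cases ha : a ∈ F
    · have h3 := (T.decreasing a ha).lt_iff_gt hy.1 hx.1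
      simp only [List.countP_cons, ha, decide_true, if_true, List.length_cons,
        Function.iterate_succ_apply, Nat.even_add_one, Nat.odd_add_one, Nat.not_even_iff_odd,
        Nat.not_odd_iff_even]
      exact ⟨fun h => h3.symm.trans (h2.2 h), fun h => h3.symm.trans (h2.1 h)⟩
    · have h3 := (T.increasing a ha).lt_iff_lt hx.1 hy.1
      simp only [List.countP_cons, ha, decide_false, Bool.false_eq_true, if_false, add_zero,
        List.length_cons, Function.iterate_succ_apply]
      exact ⟨fun h => h3.symm.trans (h1.1 h), fun h => h3.symm.trans (h1.2 h)⟩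

/-- The natural coding of a flipped interval exchange satisfies the order condition for the order
of the images of the defining intervals and the order of the defining intervals. -/
theorem flippedOrderCondition_naturalCoding [Finite A] [DecidableEq A] :
    FlippedOrderCondition F T.naturalCoding := by
  choose c d hcd hT using T.image_interval
  have hdisj : ∀ e f, e ≠ f → Disjoint (Ioo (c e) (d e)) (Ioo (c f) (d f)) := by
    intro e f h
    rw [← hT, ← hT]
    exact T.disjoint_images e f h
  have hc : Function.Injective c := by
    intro e f h
    by_contra hne
    have hd := hdisj e f hne
    rw [Set.disjoint_left] at hd
    obtain ⟨x, hx1, hx2⟩ := exists_between (lt_min (hcd e) (h ▸ hcd f : c e < d f))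
    rw [lt_min_iff] at hx2
    exact hd ⟨hx1, hx2.1⟩ ⟨h ▸ hx1, hx2.2⟩
  have himg : ∀ {a : A} {w : List A} {x : ℝ}, T.Follows (a :: w) x → T.toFun x ∈ Ioo (c a) (d a) :=
    fun {a w x} hx => hT a ▸ mem_image_of_mem _ hx.1
  refine ⟨LinearOrder.lift' c hc, LinearOrder.lift' T.left T.left_injective, fun w _ => ?_⟩
  have key : ∀ {a b e f : A}, a :: (w ++ [e]) ∈ T.naturalCoding →
      b :: (w ++ [f]) ∈ T.naturalCoding → a ≠ b → e ≠ f → ∃ x y x' y' : ℝ,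
      (c a < c b ↔ x < y) ∧ (T.left e < T.left f ↔ x' < y') ∧ (T.left f < T.left e ↔ y' < x') ∧
      (Even (w.countP (· ∈ F)) → (x < y ↔ x' < y')) ∧
      (Odd (w.countP (· ∈ F)) → (x < y ↔ y' < x')) := by
    intro a b e f h1 h2 hab hef
    obtain ⟨x, -, hx⟩ := T.mem_naturalCoding_iff.1 h1
    obtain ⟨y, -, hy⟩ := T.mem_naturalCoding_iff.1 h2
    have hx' := T.follows_append.1 hx.2
    have hy' := T.follows_append.1 hy.2
    refine ⟨T.toFun x, T.toFun y, _, _,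
      lt_iff_left_lt_of_disjoint_Ioo (hdisj a b hab) (himg hx) (himg hy),
      lt_iff_left_lt_of_disjoint_Ioo (T.disjoint_intervals e f hef) hx'.2.1 hy'.2.1,
      lt_iff_left_lt_of_disjoint_Ioo (T.disjoint_intervals f e hef.symm) hy'.2.1 hx'.2.1,
      (hx'.1.lt_iff hy'.1).1, (hx'.1.lt_iff hy'.1).2⟩
  constructor
  · intro hw a b e f h1 h2 hab hef
    obtain ⟨x, y, x', y', k1, k2, -, k4, -⟩ := key h1 h2 hab hef
    exact k1.trans ((k4 hw).trans k2.symm)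
  · intro hw a b e f h1 h2 hab hef
    obtain ⟨x, y, x', y', k1, -, k3, -, k5⟩ := key h1 h2 hab hef
    exact k1.trans ((k5 hw).trans k3.symm)

end Order

/-! ### Recurrence and wandering intervals -/

section Recurrence

variable {A : Type*} {F : Finset A} (T : FlippedIET A F)

theorem isRecurrentLanguage_naturalCoding [Finite A] (hT : ¬ ∃ J : Set ℝ, T.IsWanderingInterval J) :
    IsRecurrentLanguage T.naturalCoding := by
  intro v hv
  obtain ⟨y₀, hy₀, hv₀⟩ := T.mem_naturalCoding_iff.1 hv
  obtain ⟨a, b, hab, hJ⟩ := (T.isOpen_domain.inter (T.isOpen_follows v)).exists_Ioo_subset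
    ⟨y₀, hy₀, hv₀⟩
  -- The interval of the points following `v` is not wandering.
  have hret : ∃ n : ℕ, 0 < n ∧ ∃ y ∈ Ioo a b ∩ T.forwardDomain, T.toFun^[n] y ∈ Ioo a b := by
    by_contra hcon
    push Not at hcon
    refine hT ⟨Ioo a b, ordConnected_Ioo, (Ioo_infinite hab).nontrivial,
      fun x hx => T.domain_subset_Icc (hJ hx).1, fun n hn => ?_⟩
    rw [Set.disjoint_left]
    rintro _ ⟨y, hy, rfl⟩
    exact hcon n hn y hy
  obtain ⟨n, hn, y, ⟨hyJ, hyF⟩, hny⟩ := hret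
  choose x hx using fun i => mem_iUnion.1 (hyF i)
  have hW : T.Follows ((List.range (v.length + n)).map x) y := T.follows_map_range fun i _ => hx i
  generalize hWdef : (List.range (v.length + n)).map x = W at hW
  have hWl : W.length = v.length + n := by simp [← hWdef]
  have hpre : W.take v.length = v := by
    rw [← List.take_append_drop v.length W, follows_append] at hW
    exact hW.1.eq_of_length_eq (hJ hyJ).2 (by simp [hWl])
  have hsuf : W.drop n = v := by
    rw [← List.take_append_drop n W, follows_append] at hW
    have h2 := hW.2
    rw [List.length_take, hWl, min_eq_left (by omega)] at h2
    exact h2.eq_of_length_eq (hJ hny).2 (by simp [hWl])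
  have hWv : v ++ W.drop v.length = W := by
    conv_rhs => rw [← List.take_append_drop v.length W, hpre]
  refine ⟨W.drop v.length, ?_, ?_, ?_, ?_⟩
  · rw [← hWv, follows_append] at hW
    exact T.mem_naturalCoding_iff.2 ⟨_, hyF v.length, hW.2⟩
  · intro h
    have := congrArg List.length h
    simp only [List.length_drop, List.length_nil] at this
    omega
  · rw [hWv]
    exact T.mem_naturalCoding_iff.2 ⟨y, (hJ hyJ).1, hW⟩
  · rw [hWv]
    conv_lhs => rw [← hsuf]
    exact List.drop_suffix n W

open MeasureTheory in
/-- A standard flipped interval exchange preserves the Lebesgue measure, so the Poincaré recurrence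
theorem forbids wandering intervals. -/
theorem IsStandard.not_isWanderingInterval [Finite A] {T : FlippedIET A F} (hT : T.IsStandard) :
    ¬ ∃ J : Set ℝ, T.IsWanderingInterval J := by
  classical
  have := Fintype.ofFinite A
  rintro ⟨J, hJc, hJn, hJI, hJ⟩
  choose s t hs hst using hT
  -- A measurable modification of the map, equal to it on the domain.
  let g : ℝ → ℝ := fun x => if h : ∃ e, x ∈ T.interval e then s h.choose * x + t h.choose else x
  have hg : ∀ e, ∀ x ∈ T.interval e, g x = s e * x + t e := by
    intro e x hx
    have h : ∃ e, x ∈ T.interval e := ⟨e, hx⟩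
    simp only [g, dif_pos h]
    rw [T.eq_of_mem_interval h.choose_spec hx]
  have hgT : ∀ x ∈ T.domain, g x = T.toFun x := by
    intro x hx
    obtain ⟨e, he⟩ := mem_iUnion.1 hx
    rw [hg e x he, hst e x he]
  have hpre : ∀ S : Set ℝ, g ⁻¹' S =
      (⋃ e, T.interval e ∩ (fun x => s e * x + t e) ⁻¹' S) ∪ (T.domainᶜ ∩ S) := by
    intro S
    ext x
    by_cases hx : x ∈ T.domain
    · obtain ⟨e, he⟩ := mem_iUnion.1 hx
      simp only [mem_preimage, mem_union, mem_iUnion, mem_inter_iff, mem_compl_iff, hx,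
        not_true_eq_false, false_and, or_false, hg e x he]
      refine ⟨fun h => ⟨e, he, h⟩, ?_⟩
      rintro ⟨f, hf, h⟩
      rwa [T.eq_of_mem_interval he hf]
    · have hx' : ¬ ∃ e, x ∈ T.interval e := fun h => hx (mem_iUnion.2 h)
      have hgx : g x = x := by simp only [g, dif_neg hx']
      rw [mem_preimage, hgx, mem_union, mem_iUnion]
      refine ⟨fun h => Or.inr ⟨hx, h⟩, ?_⟩
      rintro (⟨e, he, -⟩ | h)
      · exact absurd ⟨e, he⟩ hx'
      · exact h.2
  have hmeas : Measurable g := by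
    intro S hS
    rw [hpre]
    refine (MeasurableSet.iUnion fun e => ?_).union (T.isOpen_domain.measurableSet.compl.inter hS)
    exact measurableSet_Ioo.inter (((measurable_const.mul measurable_id).add_const _) hS)
  have hmp : ∀ e, MeasurePreserving (fun x : ℝ => s e * x + t e) volume volume := by
    intro e
    rcases hs e with h | h
    · simpa [h] using measurePreserving_add_right (volume : Measure ℝ) (t e)
    · simpa [h, Function.comp_def] using
        (measurePreserving_add_right (volume : Measure ℝ) (t e)).comp
          (Measure.measurePreserving_neg (volume : Measure ℝ))
  have himg : ∀ e, T.toFun '' T.interval e = (fun x => s e * x + t e) '' T.interval e :=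
    fun e => image_congr (hst e)
  have hopen : ∀ e, MeasurableSet (T.toFun '' T.interval e) := by
    intro e
    obtain ⟨c, d, -, h⟩ := T.image_interval e
    exact (h ▸ measurableSet_Ioo : MeasurableSet (T.toFun '' Ioo (T.left e) (T.right e)))
  let μ : Measure ℝ := volume.restrict T.domain
  have hmpg : MeasurePreserving g μ μ := by
    refine ⟨hmeas, ?_⟩
    ext S hS
    rw [Measure.map_apply hmeas hS, Measure.restrict_apply (hmeas hS), Measure.restrict_apply hS]
    have h1 : g ⁻¹' S ∩ T.domain = ⋃ e, T.interval e ∩ (fun x => s e * x + t e) ⁻¹' S := by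
      rw [hpre, union_inter_distrib_right, inter_right_comm, compl_inter_self, empty_inter,
        union_empty, inter_eq_left]
      exact iUnion_mono fun e => inter_subset_left
    have h2 : ∀ e, volume (T.interval e ∩ (fun x => s e * x + t e) ⁻¹' S) =
        volume (S ∩ T.toFun '' T.interval e) := by
      intro e
      have hinj : Function.Injective (fun x : ℝ => s e * x + t e) := by
        intro x y hxy
        rcases hs e with h | h <;> simp only [h] at hxy <;> linarith
      rw [← (hmp e).measure_preimage (hS.inter (hopen e)).nullMeasurableSet, preimage_inter,
        himg, hinj.preimage_image, inter_comm]
    have hae : (T.toFun '' T.domain : Set ℝ) =ᵐ[volume] (T.domain : Set ℝ) := by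
      have hd : (T.domain : Set ℝ) =ᵐ[volume] (Icc 0 1 : Set ℝ) := by
        refine (LE.le.eventuallyLE T.domain_subset_Icc).antisymm ?_
        rw [ae_le_set]
        exact T.countable_Icc_diff_domain.measure_zero _
      have hi : (T.toFun '' T.domain : Set ℝ) =ᵐ[volume] (Icc 0 1 : Set ℝ) := by
        refine (LE.le.eventuallyLE T.image_domain_subset_Icc).antisymm ?_
        rw [ae_le_set]
        exact T.countable_Icc_diff_image.measure_zero _
      exact hi.trans hd.symm
    rw [h1, measure_iUnion, ← measure_congr (ae_eq_set_inter (ae_eq_refl S) hae),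
      domain, image_iUnion, inter_iUnion, measure_iUnion]
    · exact tsum_congr h2
    · exact fun e f h => (T.disjoint_images e f h).mono inter_subset_right inter_subset_right
    · exact fun e => hS.inter (hopen e)
    · exact fun e f h => (T.disjoint_intervals e f h).mono inter_subset_left inter_subset_left
    · exact fun e => measurableSet_Ioo.inter ((hmp e).measurable hS)
  have hfin : IsFiniteMeasure μ := by
    refine ⟨?_⟩
    rw [Measure.restrict_apply_univ]
    exact (measure_mono T.domain_subset_Icc).trans_lt (by simp)
  obtain ⟨G, hGd, hGc, hG⟩ := T.exists_bijOn
  have hiter : ∀ x ∈ G, ∀ n : ℕ, T.toFun^[n] x ∈ G := fun x hx n => hG.mapsTo.iterate n hx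
  have hgiter : ∀ x ∈ G, ∀ n : ℕ, g^[n] x = T.toFun^[n] x := by
    intro x hx n
    induction n with
    | zero => rfl
    | succ n ih =>
      rw [Function.iterate_succ_apply', Function.iterate_succ_apply', ih,
        hgT _ (hGd (hiter x hx n))]
  have hJG : J \ (Icc 0 1 \ G) ⊆ G := by
    intro x hx
    by_contra h
    exact hx.2 ⟨hJI hx.1, h⟩
  have hpos : μ (J \ (Icc 0 1 \ G)) ≠ 0 := by
    rw [Measure.restrict_apply (hJc.measurableSet.diff hGc.measurableSet),
      inter_eq_left.2 (hJG.trans hGd), measure_sdiff_null (hGc.measure_zero _)]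
    obtain ⟨a, ha, b, hb, hab⟩ := hJn.exists_lt
    refine ((?_ : (0 : ENNReal) < volume (Icc a b)).trans_le
      (measure_mono (hJc.out ha hb))).ne'
    simpa using hab
  obtain ⟨x, hx, m, hm, hxm⟩ := hmpg.conservative.exists_mem_iterate_mem
    (hJc.measurableSet.diff hGc.measurableSet).nullMeasurableSet hpos
  have hxG := hJG hx
  rw [hgiter x hxG] at hxm
  exact Set.disjoint_left.1 (hJ m (Nat.pos_of_ne_zero hm))
    (mem_image_of_mem _ ⟨hx.1, fun n => hGd (hiter x hxG n)⟩) hxm.1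

end Recurrence

end FlippedIET

/-! ### Factors of words of a language -/

section Languages

variable {A : Type*} {L : Language A}

lemma IsFactorialExtendable.mem_of_append_mem (hL : IsFactorialExtendable L) {u v : List A}
    (h : u ++ v ∈ L) : u ∈ L := by
  induction v using List.reverseRecOn with
  | nil => simpa using h
  | append_singleton v b ih => exact ih (hL.init_mem _ b (by simpa using h))

lemma IsFactorialExtendable.mem_of_append_mem_right (hL : IsFactorialExtendable L) {u v : List A}
    (h : u ++ v ∈ L) : v ∈ L := by
  induction u with
  | nil => simpa using h
  | cons a u ih => exact ih (hL.tail_mem a _ (by simpa using h))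

end Languages

/-! ### Intervals placed side by side -/

section Sums

variable {A : Type*} [Fintype A]

open Classical in
/-- The total weight of the letters that precede `c` for the relation `R`. -/
noncomputable def sumBelow (R : A → A → Prop) (f : A → ℝ) (c : A) : ℝ :=
  ∑ d, if R d c then f d else 0

variable {R : A → A → Prop} {f : A → ℝ}

lemma sumBelow_nonneg (hf : ∀ d, 0 ≤ f d) (c : A) : 0 ≤ sumBelow R f c :=
  Finset.sum_nonneg fun d _ => by split_ifs <;> simp [hf]

lemma sumBelow_add_add_sumBelow [IsStrictTotalOrder A R] (c : A) :
    sumBelow R f c + f c + sumBelow (fun x y => R y x) f c = ∑ d, f d := by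
  classical
  have h : f c = ∑ d, if d = c then f d else 0 := by simp
  rw [sumBelow, sumBelow, h, ← Finset.sum_add_distrib, ← Finset.sum_add_distrib]
  refine Finset.sum_congr rfl fun d _ => ?_
  rcases trichotomous_of R d c with h | h | h
  · have h1 : d ≠ c := fun h' => irrefl_of R c (h' ▸ h)
    have h2 : ¬ R c d := fun h' => irrefl_of R c (trans_of R h' h)
    simp [h, h1, h2]
  · subst h
    simp [irrefl_of R d]
  · have h1 : d ≠ c := fun h' => irrefl_of R c (h' ▸ h)
    have h2 : ¬ R d c := fun h' => irrefl_of R c (trans_of R h h')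
    simp [h, h1, h2]

lemma sumBelow_add_le_sum [IsStrictTotalOrder A R] (hf : ∀ d, 0 ≤ f d) (c : A) :
    sumBelow R f c + f c ≤ ∑ d, f d := by
  rw [← sumBelow_add_add_sumBelow (R := R) c]
  linarith [sumBelow_nonneg (R := fun x y => R y x) hf c]

lemma sumBelow_add_le_sumBelow [IsStrictTotalOrder A R] (hf : ∀ d, 0 ≤ f d) {c c' : A}
    (h : R c c') : sumBelow R f c + f c ≤ sumBelow R f c' := by
  classical
  have hc : f c = ∑ d, if d = c then f d else 0 := by simp
  rw [sumBelow, sumBelow, hc, ← Finset.sum_add_distrib]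
  refine Finset.sum_le_sum fun d _ => ?_
  by_cases h1 : R d c
  · have h2 : d ≠ c := fun h' => irrefl_of R c (h' ▸ h1)
    simp [h1, h2, trans_of R h1 h]
  · by_cases h2 : d = c
    · subst h2
      simp [h1, h]
    · simp only [h1, h2, if_false, add_zero]
      split_ifs <;> simp [hf]

/-- The intervals of the letters of positive weight, placed side by side in the order `R`, cover
the interval whose length is the total weight. -/
lemma exists_mem_Icc_sumBelow [IsStrictTotalOrder A R] (hf : ∀ d, 0 ≤ f d) (hpos : 0 < ∑ d, f d)
    {t : ℝ} (ht : t ∈ Icc 0 (∑ d, f d)) :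
    ∃ c, 0 < f c ∧ t ∈ Icc (sumBelow R f c) (sumBelow R f c + f c) := by
  classical
  have wf : WellFounded R := Finite.wellFounded_of_trans_of_irrefl R
  have wf' : WellFounded (fun x y => R y x) := Finite.wellFounded_of_trans_of_irrefl _
  let S : Set A := {c | 0 < f c ∧ t ≤ sumBelow R f c + f c}
  have hS : S.Nonempty := by
    have hne : {c | 0 < f c}.Nonempty := by
      obtain ⟨c, -, hc⟩ := Finset.exists_lt_of_sum_lt (s := Finset.univ) (f := fun _ : A => (0 : ℝ))
        (g := f) (by simpa using hpos)
      exact ⟨c, hc⟩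
    obtain ⟨c, hc, hmax⟩ := wf'.has_min _ hne
    refine ⟨c, hc, ht.2.trans ?_⟩
    rw [← sumBelow_add_add_sumBelow (R := R) c]
    have : sumBelow (fun x y => R y x) f c = 0 := by
      refine Finset.sum_eq_zero fun d _ => ?_
      split_ifs with h
      · by_contra hd
        exact hmax d (lt_of_le_of_ne (hf d) (Ne.symm hd)) h
      · rfl
    linarith
  obtain ⟨c, ⟨hc, htc⟩, hmin⟩ := wf.has_min S hS
  refine ⟨c, hc, ?_, htc⟩
  by_contra hlt
  rw [not_le] at hlt
  have hne : {d | R d c ∧ 0 < f d}.Nonempty := by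
    by_contra hem
    have : sumBelow R f c = 0 := by
      refine Finset.sum_eq_zero fun d _ => ?_
      split_ifs with h
      · by_contra hd
        exact hem ⟨d, h, lt_of_le_of_ne (hf d) (Ne.symm hd)⟩
      · rfl
    linarith [ht.1]
  obtain ⟨d, ⟨hdc, hd⟩, hmax⟩ := wf'.has_min _ hne
  have hle : sumBelow R f c ≤ sumBelow R f d + f d := by
    have hfd : f d = ∑ e, if e = d then f e else 0 := by simp
    rw [sumBelow, sumBelow, hfd, ← Finset.sum_add_distrib]
    refine Finset.sum_le_sum fun e _ => ?_
    by_cases h1 : R e c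
    · rcases trichotomous_of R e d with h | h | h
      · have : e ≠ d := fun h' => irrefl_of R d (h' ▸ h)
        simp [h1, h, this]
      · subst h
        simp [h1, irrefl_of R e]
      · have h0 : f e = 0 := by
          by_contra hne0
          exact hmax e ⟨h1, lt_of_le_of_ne (hf e) (Ne.symm hne0)⟩ h
        simp [h0]
    · rw [if_neg h1]
      exact add_nonneg (by split_ifs <;> simp [hf]) (by split_ifs <;> simp [hf])
  exact hmin d ⟨hd, by linarith⟩ hdc

/-- The identity behind the compatibility of the two orders: when the support of `f` is monotone
with respect to its point `(a, c)`, the weight of the region below `(a, c)` can be computed by rows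
or by columns. -/
lemma sumBelow_sum_comm {RA RD : A → A → Prop} [IsStrictTotalOrder A RA] [IsStrictTotalOrder A RD]
    {f : A → A → ℝ} {a c : A}
    (h : ∀ b d, f b d ≠ 0 → b ≠ a → d ≠ c → (RA b a ↔ RD d c)) :
    sumBelow RD (fun d => ∑ b, f b d) c + sumBelow RA (fun b => f b c) a =
      sumBelow RA (fun b => ∑ d, f b d) a + sumBelow RD (f a) c := by
  classical
  have h1 : sumBelow RD (fun d => ∑ b, f b d) c = ∑ b, ∑ d, if RD d c then f b d else 0 := by
    rw [sumBelow, Finset.sum_comm]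
    exact Finset.sum_congr rfl fun d _ => by split_ifs <;> simp
  have h2 : sumBelow RA (fun b => f b c) a =
      ∑ b, ∑ d, if d = c then (if RA b a then f b d else 0) else 0 := by
    simp [sumBelow]
  have h3 : sumBelow RA (fun b => ∑ d, f b d) a = ∑ b, ∑ d, if RA b a then f b d else 0 := by
    rw [sumBelow]
    exact Finset.sum_congr rfl fun d _ => by split_ifs <;> simp
  have h4 : sumBelow RD (f a) c =
      ∑ b, ∑ d, if b = a then (if RD d c then f b d else 0) else 0 := by
    rw [Finset.sum_comm]
    simp [sumBelow]
  rw [h1, h2, h3, h4, ← Finset.sum_add_distrib, ← Finset.sum_add_distrib]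
  refine Finset.sum_congr rfl fun b _ => ?_
  rw [← Finset.sum_add_distrib, ← Finset.sum_add_distrib]
  refine Finset.sum_congr rfl fun d _ => ?_
  by_cases hb : b = a
  · subst hb
    by_cases hd : d = c
    · subst hd
      simp [irrefl_of RA b]
    · simp [irrefl_of RA b, hd]
  · by_cases hd : d = c
    · subst hd
      simp [irrefl_of RD d, hb]
    · by_cases h0 : f b d = 0
      · simp [h0]
      · simp [hb, hd, h b d h0 hb hd]

end Sums

/-! ### Invariant weights -/

section Weights

variable {A : Type*} [Fintype A]

/-- A shift-invariant probability on the words: the values `μ w` are the measures of the cylinders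
of a shift-invariant probability measure on `A^ℤ`. -/
structure IsInvariantWeight (μ : List A → ℝ) : Prop where
  nonneg : ∀ w, 0 ≤ μ w
  nil : μ [] = 1
  sum_cons : ∀ w, ∑ a, μ (a :: w) = μ w
  sum_concat : ∀ w, ∑ b, μ (w ++ [b]) = μ w

namespace IsInvariantWeight

variable {μ : List A → ℝ} (hμ : IsInvariantWeight μ)
include hμ

lemma append_right_le (u v : List A) : μ (u ++ v) ≤ μ u := by
  induction v using List.reverseRecOn with
  | nil => simp
  | append_singleton v b ih =>
    refine le_trans ?_ ih
    rw [← hμ.sum_concat (u ++ v), ← List.append_assoc]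
    exact Finset.single_le_sum (f := fun b => μ (u ++ v ++ [b])) (fun b _ => hμ.nonneg _)
      (Finset.mem_univ b)

lemma append_left_le (u v : List A) : μ (u ++ v) ≤ μ v := by
  induction u with
  | nil => simp
  | cons a u ih =>
    refine le_trans ?_ ih
    rw [← hμ.sum_cons (u ++ v)]
    exact Finset.single_le_sum (f := fun a => μ (a :: (u ++ v))) (fun b _ => hμ.nonneg _)
      (Finset.mem_univ a)

lemma pos_of_ne_zero {w : List A} (h : μ w ≠ 0) : 0 < μ w := lt_of_le_of_ne (hμ.nonneg w) h.symm

lemma exists_concat_pos {w : List A} (h : 0 < μ w) : ∃ b, 0 < μ (w ++ [b]) := by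
  rw [← hμ.sum_concat w] at h
  obtain ⟨b, -, hb⟩ := Finset.exists_lt_of_sum_lt (s := Finset.univ) (f := fun _ : A => (0 : ℝ))
    (g := fun b => μ (w ++ [b])) (by simpa using h)
  exact ⟨b, hb⟩

end IsInvariantWeight

end Weights

/-! ### Flipped lexicographic positions -/

section Lower

variable {A : Type*} [DecidableEq A]

/-- The relation `r` or its reverse, according to the parity of the number of letters of `F`
in `p`. -/
def dirLT (F : Finset A) (r : A → A → Prop) (p : List A) : A → A → Prop :=
  if Even (p.countP (· ∈ F)) then r else fun c d => r d c

variable {F : Finset A} {r : A → A → Prop}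

instance [IsStrictTotalOrder A r] (p : List A) : IsStrictTotalOrder A (dirLT F r p) := by
  unfold dirLT
  split_ifs
  · infer_instance
  · exact { trichotomous := fun a b h1 h2 => (Std.Trichotomous.trichotomous b a h1 h2).symm
            irrefl := fun a => irrefl_of r a
            trans := fun a b c h1 h2 => trans_of r h2 h1 }

lemma dirLT_cons_of_mem {a : A} (ha : a ∈ F) (p : List A) :
    dirLT F r (a :: p) = fun c d => dirLT F r p d c := by
  unfold dirLT
  by_cases h : Even (p.countP (· ∈ F)) <;> simp [ha, h, Nat.even_add_one]

lemma dirLT_cons_of_notMem {a : A} (ha : a ∉ F) (p : List A) :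
    dirLT F r (a :: p) = dirLT F r p := by
  simp [dirLT, ha]

variable [Fintype A]

/-- The total weight of the words `p ++ u`, with `u` of the length of `w`, that precede `p ++ w` in
the lexicographic order in which the letters after a prefix `q` are compared by `dirLT F r q`.
Thus a word `w` occupies the interval from `lowerEnd F r μ [] w` to `lowerEnd F r μ [] w + μ w` when
the words of a given length are placed side by side. -/
noncomputable def lowerEnd (F : Finset A) (r : A → A → Prop) (μ : List A → ℝ) :
    List A → List A → ℝ
  | _, [] => 0
  | p, c :: w => sumBelow (dirLT F r p) (fun d => μ (p ++ [d])) c + lowerEnd F r μ (p ++ [c]) w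

variable {μ : List A → ℝ}

lemma lowerEnd_append (p u v : List A) :
    lowerEnd F r μ p (u ++ v) = lowerEnd F r μ p u + lowerEnd F r μ (p ++ u) v := by
  induction u generalizing p with
  | nil => simp [lowerEnd]
  | cons c u ih => simp [lowerEnd, ih, add_assoc]

variable [IsStrictTotalOrder A r]

section
variable (hμ : IsInvariantWeight μ)
include hμ

omit [IsStrictTotalOrder A r] in
lemma lowerEnd_nonneg (p w : List A) : 0 ≤ lowerEnd F r μ p w := by
  induction w generalizing p with
  | nil => simp [lowerEnd]
  | cons c w ih => exact add_nonneg (sumBelow_nonneg (fun d => hμ.nonneg _) c) (ih _)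

lemma lowerEnd_add_le (p w : List A) : lowerEnd F r μ p w + μ (p ++ w) ≤ μ p := by
  induction w generalizing p with
  | nil => simp [lowerEnd]
  | cons c w ih =>
    have h1 := sumBelow_add_le_sum (R := dirLT F r p) (f := fun d => μ (p ++ [d]))
      (fun d => hμ.nonneg _) c
    rw [hμ.sum_concat] at h1
    have h2 := ih (p ++ [c])
    rw [List.append_assoc, List.singleton_append] at h2
    rw [lowerEnd]
    linarith

lemma lowerEnd_append_mem (u v : List A) :
    lowerEnd F r μ [] u ≤ lowerEnd F r μ [] (u ++ v) ∧
      lowerEnd F r μ [] (u ++ v) + μ (u ++ v) ≤ lowerEnd F r μ [] u + μ u := by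
  rw [lowerEnd_append]
  have h1 := lowerEnd_nonneg (F := F) (r := r) hμ ([] ++ u) v
  have h2 := lowerEnd_add_le (F := F) (r := r) hμ ([] ++ u) v
  rw [List.nil_append] at *
  constructor <;> linarith

lemma lowerEnd_mem_unit (w : List A) :
    0 ≤ lowerEnd F r μ [] w ∧ lowerEnd F r μ [] w + μ w ≤ 1 :=
  ⟨lowerEnd_nonneg hμ _ _, hμ.nil ▸ lowerEnd_add_le hμ [] w⟩

/-- The intervals of distinct words of the same length do not overlap. -/
lemma eq_of_mem_Ioo_lowerEnd {u v : List A} (h : u.length = v.length) {t : ℝ}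
    (hu : t ∈ Ioo (lowerEnd F r μ [] u) (lowerEnd F r μ [] u + μ u))
    (hv : t ∈ Ioo (lowerEnd F r μ [] v) (lowerEnd F r μ [] v + μ v)) : u = v := by
  induction u using List.reverseRecOn generalizing v with
  | nil => exact (List.length_eq_zero_iff.1 h.symm).symm
  | append_singleton u c ih =>
    rcases List.eq_nil_or_concat' v with rfl | ⟨v, d, rfl⟩
    · simp at h
    · have h1 := lowerEnd_append_mem (F := F) (r := r) hμ u [c]
      have h2 := lowerEnd_append_mem (F := F) (r := r) hμ v [d]
      obtain rfl : u = v := ih (by simpa using h)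
        ⟨h1.1.trans_lt hu.1, hu.2.trans_le h1.2⟩ ⟨h2.1.trans_lt hv.1, hv.2.trans_le h2.2⟩
      simp only [lowerEnd_append, lowerEnd, List.nil_append, add_zero] at hu hv
      rcases trichotomous_of (dirLT F r u) c d with hcd | rfl | hcd
      · have := sumBelow_add_le_sumBelow (f := fun d => μ (u ++ [d])) (fun d => hμ.nonneg _) hcd
        linarith [hu.2, hv.1]
      · rfl
      · have := sumBelow_add_le_sumBelow (f := fun d => μ (u ++ [d])) (fun d => hμ.nonneg _) hcd
        linarith [hv.2, hu.1]

/-- The intervals of the words of positive weight of a given length cover `[0,1]`. -/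
lemma exists_mem_Icc_lowerEnd (n : ℕ) {t : ℝ} (ht : t ∈ Icc (0 : ℝ) 1) :
    ∃ u : List A, u.length = n ∧ 0 < μ u ∧
      t ∈ Icc (lowerEnd F r μ [] u) (lowerEnd F r μ [] u + μ u) := by
  induction n with
  | zero => exact ⟨[], rfl, by simp [hμ.nil], by simpa [lowerEnd, hμ.nil] using ht⟩
  | succ n ih =>
    obtain ⟨u, hul, hu, htu⟩ := ih
    obtain ⟨c, hc, htc⟩ := exists_mem_Icc_sumBelow (R := dirLT F r u)
      (f := fun d => μ (u ++ [d])) (t := t - lowerEnd F r μ [] u) (fun d => hμ.nonneg _)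
      (by rwa [hμ.sum_concat])
      (by rw [hμ.sum_concat]; exact ⟨by linarith [htu.1], by linarith [htu.2]⟩)
    refine ⟨u ++ [c], by simp [hul], hc, ?_⟩
    simp only [lowerEnd_append, lowerEnd, List.nil_append, add_zero]
    exact ⟨by linarith [htc.1], by linarith [htc.2]⟩

end

/-! ### The isometries carried by the letters -/

/-- The isometry by which the letter `a` acts: it maps the interval of `a` for the order `r` onto
the interval of `a` for the order `rA`, reversing the orientation if `a ∈ F`. -/
noncomputable def slide (F : Finset A) (rA r : A → A → Prop) (μ : List A → ℝ) (a : A) (t : ℝ) : ℝ :=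
  if a ∈ F then sumBelow rA (fun b => μ [b]) a + lowerEnd F r μ [] [a] + μ [a] - t
  else sumBelow rA (fun b => μ [b]) a + t - lowerEnd F r μ [] [a]

variable {rA : A → A → Prop} [IsStrictTotalOrder A rA] {L : Language A}

section
variable (hL : IsFactorialExtendable L) (hO : ∀ p, OrderConditionAt L p rA (dirLT F r p))
  (hμ : IsInvariantWeight μ) (hμL : ∀ w, μ w ≠ 0 → w ∈ L)
include hL hO hμ hμL

omit hL in
lemma sumBelow_step {a c : A} {p : List A} (h : a :: (p ++ [c]) ∈ L) :
    sumBelow (dirLT F r p) (fun d => μ (p ++ [d])) c +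
        sumBelow rA (fun b => μ (b :: (p ++ [c]))) a =
      sumBelow rA (fun b => μ (b :: p)) a +
        sumBelow (dirLT F r p) (fun d => μ (a :: (p ++ [d]))) c := by
  have key := sumBelow_sum_comm (RA := rA) (RD := dirLT F r p)
    (f := fun b d => μ (b :: (p ++ [d]))) (a := a) (c := c)
    fun b d hbd hb hd => hO p b a d c (hμL _ hbd) h hb hd
  simp only [hμ.sum_cons] at key
  simp only [← List.cons_append, hμ.sum_concat] at key
  simpa using key

/-- For `a ∉ F`, the position of `p ++ w` among the words starting with `p` and that of
`a :: (p ++ w)` among those starting with `a :: p` differ as the images prescribed by `rA` do. -/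
lemma lowerEnd_cons_of_notMem {a : A} (ha : a ∉ F) (p w : List A) (h : a :: (p ++ w) ∈ L) :
    lowerEnd F r μ p w + sumBelow rA (fun b => μ (b :: (p ++ w))) a =
      sumBelow rA (fun b => μ (b :: p)) a + lowerEnd F r μ (a :: p) w := by
  induction w generalizing p with
  | nil => simp [lowerEnd]
  | cons c w ih =>
    have h' : a :: ((p ++ [c]) ++ w) ∈ L := by simpa using h
    have h1 := ih (p ++ [c]) h'
    have h2 := sumBelow_step hO hμ hμL
      (hL.mem_of_append_mem (u := a :: (p ++ [c])) (v := w) (by simpa using h'))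
    simp only [lowerEnd, dirLT_cons_of_notMem ha, List.append_assoc, List.cons_append,
      List.nil_append] at h1 h2 ⊢
    linarith

/-- The analogue of `lowerEnd_cons_of_notMem` for a letter reversing the orientation. -/
lemma lowerEnd_cons_of_mem {a : A} (ha : a ∈ F) (p w : List A) (h : a :: (p ++ w) ∈ L) :
    lowerEnd F r μ p w + sumBelow rA (fun b => μ (b :: (p ++ w))) a +
        (lowerEnd F r μ (a :: p) w + μ (a :: (p ++ w))) =
      sumBelow rA (fun b => μ (b :: p)) a + μ (a :: p) := by
  induction w generalizing p with
  | nil => simp [lowerEnd]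
  | cons c w ih =>
    have h' : a :: ((p ++ [c]) ++ w) ∈ L := by simpa using h
    have h1 := ih (p ++ [c]) h'
    have h2 := sumBelow_step hO hμ hμL
      (hL.mem_of_append_mem (u := a :: (p ++ [c])) (v := w) (by simpa using h'))
    have h3 := sumBelow_add_add_sumBelow (R := dirLT F r p) (f := fun d => μ (a :: p ++ [d])) c
    rw [hμ.sum_concat] at h3
    simp only [lowerEnd, dirLT_cons_of_mem ha, List.append_assoc, List.cons_append,
      List.nil_append] at h1 h2 h3 ⊢
    linarith

/-- The isometry of `a` carries the interval of `a :: w` into the interval of `w`. -/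
lemma exists_slide_eq {a : A} {w : List A} (h : a :: w ∈ L) :
    ∃ δ, 0 ≤ δ ∧ δ + μ (a :: w) ≤ μ w ∧ ∀ t, slide F rA r μ a t = lowerEnd F r μ [] w + δ +
      if a ∈ F then lowerEnd F r μ [] (a :: w) + μ (a :: w) - t
      else t - lowerEnd F r μ [] (a :: w) := by
  refine ⟨sumBelow rA (fun b => μ (b :: w)) a, sumBelow_nonneg (fun b => hμ.nonneg _) a, ?_, ?_⟩
  · rw [← hμ.sum_cons w]
    exact sumBelow_add_le_sum (f := fun b => μ (b :: w)) (fun b => hμ.nonneg _) a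
  · intro t
    by_cases ha : a ∈ F
    · have h1 := lowerEnd_cons_of_mem hL hO hμ hμL ha [] w h
      simp only [slide, ha, if_true, lowerEnd, List.nil_append] at h1 ⊢
      linarith
    · have h1 := lowerEnd_cons_of_notMem hL hO hμ hμL ha [] w h
      simp only [slide, ha, if_false, lowerEnd, List.nil_append] at h1 ⊢
      linarith

lemma slide_mem_Icc {a : A} {w : List A} (h : a :: w ∈ L) {t : ℝ}
    (ht : t ∈ Icc (lowerEnd F r μ [] (a :: w)) (lowerEnd F r μ [] (a :: w) + μ (a :: w))) :
    slide F rA r μ a t ∈ Icc (lowerEnd F r μ [] w) (lowerEnd F r μ [] w + μ w) := by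
  obtain ⟨δ, h1, h2, h3⟩ := exists_slide_eq hL hO hμ hμL h
  rw [h3]
  split_ifs <;> constructor <;> linarith [ht.1, ht.2]

lemma slide_mem_Ioo {a : A} {w : List A} (h : a :: w ∈ L) {t : ℝ}
    (ht : t ∈ Ioo (lowerEnd F r μ [] (a :: w)) (lowerEnd F r μ [] (a :: w) + μ (a :: w))) :
    slide F rA r μ a t ∈ Ioo (lowerEnd F r μ [] w) (lowerEnd F r μ [] w + μ w) := by
  obtain ⟨δ, h1, h2, h3⟩ := exists_slide_eq hL hO hμ hμL h
  rw [h3]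
  split_ifs <;> constructor <;> linarith [ht.1, ht.2]

end

end Lower

/-! ### The interval exchange of an invariant weight -/

section Construction

variable {A : Type*} [DecidableEq A] [Fintype A] {F : Finset A} {r rA : A → A → Prop}
  {μ : List A → ℝ} {L : Language A}

open Classical in
/-- The map equal on the interval of each letter to the isometry of this letter; its value elsewhere
is irrelevant. -/
noncomputable def slideMap (F : Finset A) (rA r : A → A → Prop) (μ : List A → ℝ) (x : ℝ) : ℝ :=
  if h : ∃ a, x ∈ Ioo (lowerEnd F r μ [] [a]) (lowerEnd F r μ [] [a] + μ [a]) then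
    slide F rA r μ h.choose x else x

variable [IsStrictTotalOrder A r]

lemma slideMap_eq (hμ : IsInvariantWeight μ) {a : A} {x : ℝ}
    (hx : x ∈ Ioo (lowerEnd F r μ [] [a]) (lowerEnd F r μ [] [a] + μ [a])) :
    slideMap F rA r μ x = slide F rA r μ a x := by
  have h : ∃ a, x ∈ Ioo (lowerEnd F r μ [] [a]) (lowerEnd F r μ [] [a] + μ [a]) := ⟨a, hx⟩
  have : [h.choose] = [a] := eq_of_mem_Ioo_lowerEnd hμ rfl h.choose_spec hx
  rw [slideMap, dif_pos h, List.singleton_injective this]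

lemma slideMap_image (hμ : IsInvariantWeight μ) (a : A) :
    slideMap F rA r μ '' Ioo (lowerEnd F r μ [] [a]) (lowerEnd F r μ [] [a] + μ [a]) =
      Ioo (sumBelow rA (fun b => μ [b]) a) (sumBelow rA (fun b => μ [b]) a + μ [a]) := by
  rw [image_congr fun x hx => slideMap_eq hμ hx]
  by_cases ha : a ∈ F
  · simp only [slide, ha, if_true, image_const_sub_Ioo]
    congr 1 <;> ring
  · have h : slide F rA r μ a = fun x =>
        (sumBelow rA (fun b => μ [b]) a - lowerEnd F r μ [] [a]) + x := by
      ext x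
      rw [slide, if_neg ha]
      ring
    rw [h, image_const_add_Ioo]
    congr 1 <;> ring

variable [IsStrictTotalOrder A rA]

/-- An invariant weight whose support is a language with the order condition realizes this language
by a standard flipped interval exchange, the letters having intervals of lengths `μ [a]`. -/
theorem exists_isStandard_of_weight (hL : IsFactorialExtendable L) (hA : ∀ a : A, [a] ∈ L)
    (hO : ∀ p, OrderConditionAt L p rA (dirLT F r p))
    (hμ : IsInvariantWeight μ) (hμL : ∀ w, μ w ≠ 0 ↔ w ∈ L) :
    ∃ T : FlippedIET A F, T.IsStandard ∧ T.naturalCoding = L := by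
  have hpos : ∀ {w}, w ∈ L → 0 < μ w := fun hw => hμ.pos_of_ne_zero ((hμL _).2 hw)
  have hsupp : ∀ w, μ w ≠ 0 → w ∈ L := fun w => (hμL w).1
  have hsum : ∑ b, μ [b] = 1 := by
    rw [← hμ.nil, ← hμ.sum_cons]
  let T : FlippedIET A F :=
    { left := fun a => lowerEnd F r μ [] [a]
      right := fun a => lowerEnd F r μ [] [a] + μ [a]
      toFun := slideMap F rA r μ
      left_lt_right := fun a => by linarith [hpos (hA a)]
      disjoint_intervals := by
        intro e f hef
        rw [Set.disjoint_left]
        exact fun x he hf => hef (List.singleton_injective (eq_of_mem_Ioo_lowerEnd hμ rfl he hf))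
      closure_intervals := by
        refine Subset.antisymm (iUnion_subset fun a => ?_) fun x hx => ?_
        · have := lowerEnd_mem_unit (F := F) (r := r) hμ [a]
          exact closure_minimal (fun x hx => ⟨this.1.trans hx.1.le, hx.2.le.trans this.2⟩)
            isClosed_Icc
        · obtain ⟨u, hu, hμu, hxu⟩ := exists_mem_Icc_lowerEnd (F := F) (r := r) hμ 1 hx
          obtain ⟨a, rfl⟩ := List.length_eq_one_iff.1 hu
          refine mem_iUnion.2 ⟨a, ?_⟩
          rwa [closure_Ioo (by linarith)]
      continuous_on := by
        intro a
        refine ContinuousOn.congr (f := slide F rA r μ a) ?_ fun x hx => slideMap_eq hμ hx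
        unfold slide
        split_ifs <;> fun_prop
      increasing := by
        intro a ha x hx y hy hxy
        rw [slideMap_eq hμ hx, slideMap_eq hμ hy, slide, slide, if_neg ha, if_neg ha]
        linarith
      decreasing := by
        intro a ha x hx y hy hxy
        rw [slideMap_eq hμ hx, slideMap_eq hμ hy, slide, slide, if_pos ha, if_pos ha]
        linarith
      image_interval := fun a => ⟨_, _, by linarith [hpos (hA a)], slideMap_image hμ a⟩
      disjoint_images := by
        intro e f hef
        rw [slideMap_image hμ, slideMap_image hμ, Set.disjoint_left]
        intro x he hf
        rcases trichotomous_of rA e f with h | h | h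
        · linarith [he.2, hf.1,
            sumBelow_add_le_sumBelow (f := fun b => μ [b]) (fun b => hμ.nonneg _) h]
        · exact hef h
        · linarith [hf.2, he.1,
            sumBelow_add_le_sumBelow (f := fun b => μ [b]) (fun b => hμ.nonneg _) h]
      closure_images := by
        simp only [slideMap_image hμ]
        refine Subset.antisymm (iUnion_subset fun a => ?_) fun x hx => ?_
        · have h1 := sumBelow_nonneg (R := rA) (f := fun b => μ [b]) (fun b => hμ.nonneg _) a
          have h2 := sumBelow_add_le_sum (R := rA) (f := fun b => μ [b]) (fun b => hμ.nonneg _) a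
          rw [hsum] at h2
          exact closure_minimal (fun x hx => ⟨h1.trans hx.1.le, hx.2.le.trans h2⟩) isClosed_Icc
        · obtain ⟨a, ha, hxa⟩ := exists_mem_Icc_sumBelow (R := rA) (f := fun b => μ [b]) (t := x)
            (fun b => hμ.nonneg _) (by rw [hsum]; norm_num) (by rwa [hsum])
          refine mem_iUnion.2 ⟨a, ?_⟩
          rwa [closure_Ioo (by linarith)] }
  have hstep : ∀ {a x}, x ∈ T.interval a → T.toFun x = slide F rA r μ a x :=
    fun hx => slideMap_eq hμ hx
  have hfollow : ∀ {w : List A} {x : ℝ}, w ∈ L →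
      x ∈ Ioo (lowerEnd F r μ [] w) (lowerEnd F r μ [] w + μ w) → T.Follows w x := by
    intro w
    induction w with
    | nil => exact fun _ _ => trivial
    | cons a w ih =>
      intro x hw hx
      have h1 := lowerEnd_append_mem (F := F) (r := r) hμ [a] w
      have hxa : x ∈ T.interval a := ⟨h1.1.trans_lt hx.1, hx.2.trans_le h1.2⟩
      refine ⟨hxa, ?_⟩
      rw [hstep hxa]
      exact ih (hL.tail_mem a w hw) (slide_mem_Ioo hL hO hμ hsupp hw hx)
  refine ⟨T, fun a => ?_, ?_⟩
  · by_cases ha : a ∈ F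
    · refine ⟨-1, sumBelow rA (fun b => μ [b]) a + lowerEnd F r μ [] [a] + μ [a],
        Or.inr rfl, fun x hx => ?_⟩
      rw [hstep hx, slide, if_pos ha, sub_eq_neg_add, neg_one_mul]
    · refine ⟨1, sumBelow rA (fun b => μ [b]) a - lowerEnd F r μ [] [a],
        Or.inl rfl, fun x hx => ?_⟩
      rw [hstep hx, slide, if_neg ha]
      ring
  · ext w
    rw [T.mem_naturalCoding_iff]
    constructor
    · rintro ⟨x, hx, hw⟩
      -- Points near `x` follow `w`, and some of them lie inside the interval of a word of `L`.
      obtain ⟨u, hul, hu, hxu⟩ :=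
        exists_mem_Icc_lowerEnd (F := F) (r := r) hμ w.length (T.domain_subset_Icc hx)
      rw [← closure_Ioo (by linarith)] at hxu
      obtain ⟨y, hyw, hyu⟩ := mem_closure_iff.1 hxu _ (T.isOpen_follows w) hw
      have huL : u ∈ L := hsupp u hu.ne'
      rwa [← (hfollow huL hyu).eq_of_length_eq hyw hul]
    · intro hw
      -- A nonempty word starting with `w` is used to get a point of the domain.
      obtain ⟨b, hb⟩ := hL.extend_right w hw
      obtain ⟨y, hy⟩ : (Ioo (lowerEnd F r μ [] (w ++ [b]))
          (lowerEnd F r μ [] (w ++ [b]) + μ (w ++ [b]))).Nonempty :=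
        nonempty_Ioo.2 (by linarith [hpos hb])
      have hyw := hfollow hb hy
      refine ⟨y, ?_, (T.follows_append.1 hyw).1⟩
      match w with
      | [] => exact T.interval_subset_domain b hyw.1
      | a :: w => exact T.interval_subset_domain a hyw.1

end Construction

/-! ### Returning sequences -/

section Windows

variable {A : Type*}

/-- The factor of length `m` of the sequence `y` at the position `i`. -/
def window (y : ℕ → A) (i m : ℕ) : List A := (List.range m).map fun j => y (i + j)

variable {y z : ℕ → A}

@[simp] lemma length_window (i m : ℕ) : (window y i m).length = m := by simp [window]

lemma window_succ (i m : ℕ) : window y i (m + 1) = y i :: window y (i + 1) m := by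
  simp [window, List.range_succ_eq_map, Function.comp_def, add_assoc, add_comm 1]

lemma window_succ_last (i m : ℕ) : window y i (m + 1) = window y i m ++ [y (i + m)] := by
  simp [window, List.range_succ]

lemma window_add (i m n : ℕ) : window y i (m + n) = window y i m ++ window y (i + m) n := by
  induction n with
  | zero => simp [window]
  | succ n ih =>
    rw [← add_assoc, window_succ_last, ih, window_succ_last, List.append_assoc, add_assoc]

lemma window_add_two (i m : ℕ) :
    window y i (m + 2) = y i :: (window y (i + 1) m ++ [y (i + m + 1)]) := by
  rw [window_succ, window_succ_last, add_right_comm]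

lemma window_eq_iff {i j m : ℕ} :
    window y i m = window z j m ↔ ∀ k < m, y (i + k) = z (j + k) := by
  simp [window, List.map_inj_left]

/-- Longer and longer words, each one a prefix of the next one, are the prefixes of a sequence. -/
lemma exists_window_eq {V : ℕ → List A} (h : ∀ k, V k <+: V (k + 1)) (hl : ∀ k, k ≤ (V k).length) :
    ∃ y : ℕ → A, ∀ k, V k = window y 0 (V k).length := by
  have hmono : ∀ k l, k ≤ l → V k <+: V l := by
    intro k l hkl
    induction l, hkl using Nat.le_induction with
    | base => exact List.prefix_rfl
    | succ l _ ih => exact ih.trans (h l)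
  refine ⟨fun i => (V (i + 1))[i]'(Nat.lt_of_succ_le (hl (i + 1))), fun k => ?_⟩
  refine List.ext_getElem (by simp) fun i h1 h2 => ?_
  have h3 := hl (i + 1)
  simp only [window, List.getElem_map, List.getElem_range, zero_add]
  rcases le_total k (i + 1) with hk | hk
  · exact (hmono _ _ hk).getElem h1
  · exact ((hmono _ _ hk).getElem (Nat.lt_of_succ_le h3)).symm

variable {L : Language A}

/-- A word of a recurrent language starts a sequence with all its factors in the language, each
prefix of which occurs again later. -/
lemma exists_returning_seq (hL : IsFactorialExtendable L) (hrec : IsRecurrentLanguage L)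
    {v : List A} (hv : v ∈ L) :
    ∃ y : ℕ → A, (∀ i m, window y i m ∈ L) ∧ v = window y 0 v.length ∧
      ∀ n, ∃ j, 0 < j ∧ window y j n = window y 0 n := by
  choose w hwL hw0 hvw hsuf using hrec
  let V : ℕ → {v // v ∈ L} := fun k => Nat.rec ⟨v, hv⟩ (fun _ u => ⟨u.1 ++ w u.1 u.2, hvw _ _⟩) k
  have hVs : ∀ k, (V (k + 1)).1 = (V k).1 ++ w (V k).1 (V k).2 := fun k => rfl
  have hlen : ∀ k, k ≤ (V k).1.length := by
    intro k
    induction k with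
    | zero => simp
    | succ k ih =>
      have := List.length_pos_iff.2 (hw0 (V k).1 (V k).2)
      rw [hVs, List.length_append]
      omega
  obtain ⟨y, hy⟩ := exists_window_eq (V := fun k => (V k).1) (fun k => ⟨_, rfl⟩) hlen
  refine ⟨y, fun i m => ?_, hy 0, fun n => ?_⟩
  · obtain ⟨s, hs⟩ := Nat.exists_eq_add_of_le (hlen (i + m))
    have h := (V (i + m)).2
    rw [hy (i + m), hs, window_add, window_add] at h
    simpa using hL.mem_of_append_mem_right (hL.mem_of_append_mem h)
  · obtain ⟨s, hs⟩ := hsuf (V n).1 (V n).2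
    have hl := congrArg List.length hs
    have hpos := List.length_pos_iff.2 (hw0 (V n).1 (V n).2)
    simp only [List.length_append] at hl
    refine ⟨s.length, by omega, ?_⟩
    have h1 : window y 0 s.length ++ window y (0 + s.length) (V n).1.length = s ++ (V n).1 := by
      rw [← window_add, hs, ← hVs, hy (n + 1), hVs]
      simp only [List.length_append, hl]
    have h2 := (List.append_inj h1 (by simp)).2
    rw [hy n] at h2
    simp only [length_window, zero_add] at h2
    rw [window_eq_iff] at h2 ⊢
    exact fun k hk => h2 k (hk.trans_le (hlen n))

lemma exists_return_ge (hret : ∀ n, ∃ j, 0 < j ∧ window y j n = window y 0 n) (n N : ℕ) :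
    ∃ j, N ≤ j ∧ window y j n = window y 0 n := by
  induction N with
  | zero => exact ⟨0, le_rfl, rfl⟩
  | succ N ih =>
    obtain ⟨j, hj, hjn⟩ := ih
    obtain ⟨i, hi, hin⟩ := hret (j + n)
    refine ⟨i + j, by omega, ?_⟩
    rw [window_eq_iff] at *
    intro k hk
    have := hin (j + k) (by omega)
    rw [← add_assoc] at this
    rw [this, zero_add, hjn k hk]

end Windows

/-! ### Frequencies of words in a sequence -/

section Frequencies

variable {A : Type*} [Fintype A]

/-- The limits along an ultrafilter of the frequencies of the words in the prefixes of a sequence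
form an invariant weight. -/
theorem exists_isInvariantWeight_of_seq (y : ℕ → A) :
    ∃ μ : List A → ℝ, IsInvariantWeight μ ∧ ∀ w, μ w ≠ 0 → ∃ i, window y i w.length = w := by
  classical
  let g : List A → ℕ → ℝ := fun w i => if window y i w.length = w then 1 else 0
  let ν : List A → ℕ → ℝ := fun w n => (∑ i ∈ Finset.range n, g w i) / n
  have hg0 : ∀ w i, 0 ≤ g w i := fun w i => by simp only [g]; split_ifs <;> norm_num
  have hg1 : ∀ w i, g w i ≤ 1 := fun w i => by simp only [g]; split_ifs <;> norm_num
  have hν0 : ∀ w n, 0 ≤ ν w n := fun w n =>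
    div_nonneg (Finset.sum_nonneg fun i _ => hg0 w i) n.cast_nonneg
  have hν : ∀ w n, ν w n ∈ Icc (0 : ℝ) 1 := by
    refine fun w n => ⟨hν0 w n, div_le_one_of_le₀ ?_ n.cast_nonneg⟩
    calc ∑ i ∈ Finset.range n, g w i ≤ ∑ i ∈ Finset.range n, (1 : ℝ) :=
          Finset.sum_le_sum fun i _ => hg1 w i
      _ = n := by simp
  have hlim : ∀ w, ∃ x, Tendsto (ν w) (hyperfilter ℕ : Filter ℕ) (𝓝 x) := by
    intro w
    obtain ⟨x, -, hx⟩ := isCompact_Icc.ultrafilter_le_nhds ((hyperfilter ℕ).map (ν w))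
      (by
        rw [le_principal_iff]
        exact Filter.mem_map.2 (univ_mem' (hν w)))
    exact ⟨x, hx⟩
  choose μ hμ using hlim
  have hle : (hyperfilter ℕ : Filter ℕ) ≤ atTop := Nat.hyperfilter_le_atTop
  refine ⟨μ, ⟨fun w => ge_of_tendsto' (hμ w) (hν0 w), ?_, fun w => ?_, fun w => ?_⟩, fun w hw => ?_⟩
  · refine tendsto_nhds_unique (hμ []) (tendsto_const_nhds.congr' ?_)
    filter_upwards [hle (eventually_gt_atTop 0)] with n hn
    have : (n : ℝ) ≠ 0 := by exact_mod_cast hn.ne'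
    simp [ν, g, window, this]
  · have h1 : Tendsto (fun n => ∑ a, ν (a :: w) n) (hyperfilter ℕ : Filter ℕ)
        (𝓝 (∑ a, μ (a :: w))) := tendsto_finsetSum _ fun a _ => hμ (a :: w)
    have hsum : ∀ i, ∑ a, g (a :: w) i = g w (i + 1) := by
      intro i
      have : ∀ a, (window y i (a :: w).length = a :: w) ↔
          (a = y i ∧ window y (i + 1) w.length = w) := by
        intro a
        rw [List.length_cons, window_succ, List.cons_eq_cons, eq_comm]
      simp only [g, this]
      by_cases h : window y (i + 1) w.length = w <;> simp [h]
    have h2 : ∀ n, ∑ a, ν (a :: w) n = ν w n + (g w n - g w 0) / n := by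
      intro n
      simp only [ν]
      rw [← Finset.sum_div, Finset.sum_comm, ← add_div, Finset.sum_congr rfl fun i _ => hsum i]
      congr 1
      linarith [Finset.sum_range_succ (g w) n, Finset.sum_range_succ' (g w) n]
    have h3 : Tendsto (fun n : ℕ => (g w n - g w 0) / n) atTop (𝓝 0) := by
      refine squeeze_zero_norm (a := fun n : ℕ => (1 : ℝ) / n) (fun n => ?_)
        tendsto_one_div_atTop_nhds_zero_nat
      rw [norm_div, Real.norm_natCast, Real.norm_eq_abs]
      refine div_le_div_of_nonneg_right ?_ n.cast_nonneg
      rw [abs_le]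
      constructor <;> linarith [hg0 w n, hg1 w n, hg0 w 0, hg1 w 0]
    simp only [h2] at h1
    simpa using tendsto_nhds_unique h1 ((hμ w).add (h3.mono_left hle))
  · have h1 : Tendsto (fun n => ∑ b, ν (w ++ [b]) n) (hyperfilter ℕ : Filter ℕ)
        (𝓝 (∑ b, μ (w ++ [b]))) := tendsto_finsetSum _ fun b _ => hμ (w ++ [b])
    have hsum : ∀ i, ∑ b, g (w ++ [b]) i = g w i := by
      intro i
      have : ∀ b, (window y i (w ++ [b]).length = w ++ [b]) ↔
          (b = y (i + w.length) ∧ window y i w.length = w) := by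
        intro b
        rw [List.length_append, List.length_singleton, window_succ_last]
        refine ⟨fun h => ?_, fun ⟨h1, h2⟩ => by rw [h1, h2]⟩
        have h' := List.append_inj' h rfl
        exact ⟨(List.singleton_injective h'.2).symm, h'.1⟩
      simp only [g, this]
      by_cases h : window y i w.length = w <;> simp [h]
    have h2 : ∀ n, ∑ b, ν (w ++ [b]) n = ν w n := by
      intro n
      simp only [ν]
      rw [← Finset.sum_div, Finset.sum_comm, Finset.sum_congr rfl fun i _ => hsum i]
    simp only [h2] at h1
    exact tendsto_nhds_unique h1 (hμ w)
  · by_contra hcon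
    push Not at hcon
    refine hw (tendsto_nhds_unique (hμ w) ?_)
    have : ν w = fun _ => 0 := by
      ext n
      simp [ν, g, hcon]
    rw [this]
    exact tendsto_const_nhds

end Frequencies

/-! ### Deterministic sequences -/

section Deterministic

/-- A sequence whose values outside `D` determine the next value, which meets `D` infinitely often
and takes finitely many values just after `D`, takes finitely many values: each value following `D`
starts a fixed finite path up to the next visit to `D`. -/
lemma finite_range_of_deterministic {X : Type*} {t : ℕ → X} {D S : Set X} (hS : S.Finite)
    (hDS : ∀ k, t k ∈ D → t (k + 1) ∈ S) (hfreq : ∀ N, ∃ k, N ≤ k ∧ t k ∈ D)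
    (hdet : ∀ i j, t i = t j → t i ∉ D → t (i + 1) = t (j + 1)) : (range t).Finite := by
  classical
  have hpath : ∀ l i j, t i = t j → (∀ k < l, t (i + k) ∉ D) → ∀ k ≤ l, t (i + k) = t (j + k) := by
    intro l i j hij hl k hk
    induction k with
    | zero => exact hij
    | succ k ih => exact hdet _ _ (ih (by omega)) (hl k (by omega))
  choose f hf hfD using hfreq
  have hstart : ∀ i, ∃ i₀ l, i = i₀ + l ∧ t i₀ ∈ insert (t 0) S ∧ ∀ k < l, t (i₀ + k) ∉ D := by
    intro i
    induction i with
    | zero => exact ⟨0, 0, rfl, mem_insert _ _, by simp⟩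
    | succ i ih =>
      obtain ⟨i₀, l, rfl, h0, hl⟩ := ih
      by_cases hi : t (i₀ + l) ∈ D
      · exact ⟨i₀ + l + 1, 0, rfl, Or.inr (hDS _ hi), by simp⟩
      · refine ⟨i₀, l + 1, by omega, h0, fun k hk => ?_⟩
        rcases Nat.lt_succ_iff_lt_or_eq.1 hk with h | rfl
        · exact hl k h
        · exact hi
  have hrep : ∀ x, ∃ j, (∃ i, t i = x) → t j = x := by
    intro x
    by_cases h : ∃ i, t i = x
    · obtain ⟨i, hi⟩ := h
      exact ⟨i, fun _ => hi⟩
    · exact ⟨0, fun h' => absurd h' h⟩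
  choose ρ hρ using hrep
  refine ((hS.insert (t 0)).biUnion fun x _ => (finite_Icc (ρ x) (f (ρ x))).image t).subset ?_
  rintro _ ⟨i, rfl⟩
  obtain ⟨i₀, l, rfl, h0, hl⟩ := hstart i
  have hj := hρ (t i₀) ⟨i₀, rfl⟩
  have hp := hpath l i₀ (ρ (t i₀)) hj.symm hl
  refine mem_biUnion h0 ⟨ρ (t i₀) + l, ⟨by omega, ?_⟩, (hp l le_rfl).symm⟩
  by_contra hlt
  obtain ⟨k, hk⟩ := Nat.exists_eq_add_of_le (hf (ρ (t i₀)))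
  refine hl k (by omega) ?_
  rw [hp k (by omega), ← hk]
  exact hfD _

end Deterministic

/-! ### Periodic factors -/

section Periodic

variable {A : Type*} [DecidableEq A] {F : Finset A} {rA r : A → A → Prop} {L : Language A}
  [IsStrictTotalOrder A rA]

/-- If the factors of a returning sequence `y` satisfy the order condition, then a periodic
sequence with all its factors among those of `y` contains every prefix of `y`.  Otherwise a long
factor `W` common to both is extended in `y` until both its neighbours `a`, `c` differ from the
neighbours `a'`, `c'` in the periodic sequence. Let `W'` be `W` deprived of an even number of
periods. The words `a W c` and `a' W c'` say that `a < a'` if and only if `c < c'`, the words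
`a' W' c` and `a W' c'` say that `a' < a` if and only if `c < c'`. -/
theorem not_periodic_of_returning (hO : ∀ p, OrderConditionAt L p rA (dirLT F r p))
    {y z : ℕ → A} (hy : ∀ i m, window y i m ∈ L)
    (hret : ∀ n, ∃ j, 0 < j ∧ window y j n = window y 0 n) {q : ℕ} (hq : 0 < q)
    (hz : ∀ k, z (k + q) = z k) (hzy : ∀ i m, ∃ j, window y j m = window z i m) {n : ℕ}
    (hn : ∀ i, window z i n ≠ window y 0 n) : False := by
  -- Double the period, so that it contains an even number of letters of `F`.
  obtain ⟨Q, hQ, hzQ, hev⟩ : ∃ Q, 0 < Q ∧ (∀ k, z (k + Q) = z k) ∧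
      ∀ i, Even ((window z i Q).countP (· ∈ F)) := by
    refine ⟨q + q, by omega, fun k => by rw [← add_assoc, hz, hz], fun i => ?_⟩
    have : window z (i + q) q = window z i q :=
      window_eq_iff.2 fun k _ => by rw [add_right_comm, hz]
    rw [window_add, this, List.countP_append]
    exact ⟨_, rfl⟩
  have hmul : ∀ m k, z (k + Q * m) = z k := by
    intro m
    induction m with
    | zero => simp
    | succ m ih =>
      intro k
      rw [Nat.mul_succ, ← add_assoc, hzQ, ih]
  obtain ⟨i, hi⟩ := hzy 0 (Q + n + 1)
  -- Shift the periodic sequence so that it agrees with `y` on the window at `i`.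
  have hle : i ≤ Q * i := Nat.le_mul_of_pos_left i hQ
  let x : ℕ → A := fun k => z (k + (Q * i - i))
  have hxw : ∀ j m, window x j m = window z (j + (Q * i - i)) m := fun j m =>
    window_eq_iff.2 fun k _ => by simp only [x, add_right_comm]
  have hxQ : ∀ k, x (k + Q) = x k := fun k => by
    simp only [x]
    rw [add_right_comm, hzQ]
  have hxL : ∀ j m, window x j m ∈ L := fun j m => by
    obtain ⟨k, hk⟩ := hzy (j + (Q * i - i)) m
    rw [hxw, ← hk]
    exact hy k m
  have hxn : ∀ j, window x j n ≠ window y 0 n := fun j => hxw j n ▸ hn _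
  have hxev : ∀ j, Even ((window x j Q).countP (· ∈ F)) := fun j => hxw j Q ▸ hev _
  have hxy : ∀ k < Q + n + 1, y (i + k) = x (i + k) := by
    intro k hk
    rw [window_eq_iff.1 hi k hk, zero_add, ← hmul i k]
    simp only [x]
    congr 1
    omega
  clear_value x
  have hleft : ∃ a, a < i ∧ y a ≠ x a ∧ ∀ k, a < k → k < i → y k = x k := by
    have hex : ∃ a, a < i ∧ y a ≠ x a := by
      by_contra hcon
      push Not at hcon
      refine hxn 0 (window_eq_iff.2 fun k hk => ?_)
      rw [zero_add]
      rcases lt_or_ge k i with h | h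
      · exact (hcon k h).symm
      · obtain ⟨l, rfl⟩ := Nat.exists_eq_add_of_le h
        exact (hxy l (by omega)).symm
    classical
    obtain ⟨a, ha, hmax⟩ := ((Finset.range i).filter fun a => y a ≠ x a).exists_max_image id
      (by obtain ⟨a, h1, h2⟩ := hex; exact ⟨a, by simp [h1, h2]⟩)
    simp only [Finset.mem_filter, Finset.mem_range, id] at ha hmax
    refine ⟨a, ha.1, ha.2, fun k hak hki => ?_⟩
    by_contra hne
    exact absurd (hmax k ⟨hki, hne⟩) (by omega)
  have hright : ∃ c, i + (Q + n + 1) ≤ c ∧ y c ≠ x c ∧ ∀ k, i ≤ k → k < c → y k = x k := by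
    have hex : ∃ c, i ≤ c ∧ y c ≠ x c := by
      by_contra hcon
      push Not at hcon
      obtain ⟨j, hj, hjn⟩ := exists_return_ge hret n i
      exact hxn j (hjn ▸ window_eq_iff.2 fun k hk => (hcon (j + k) (by omega)).symm)
    classical
    refine ⟨Nat.find hex, ?_, (Nat.find_spec hex).2, fun k hk hkc => ?_⟩
    · by_contra hlt
      obtain ⟨k, hk⟩ := Nat.exists_eq_add_of_le (Nat.find_spec hex).1
      exact (Nat.find_spec hex).2 (by rw [hk]; exact hxy k (by omega))
    · by_contra hne
      exact Nat.find_min hex hkc ⟨hk, hne⟩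
  obtain ⟨a, hai, hane, ha⟩ := hleft
  obtain ⟨c, hic, hcne, hc⟩ := hright
  have hagree : ∀ k, a < k → k < c → y k = x k := fun k hk hkc =>
    (lt_or_ge k i).elim (ha k hk) fun h => hc k h hkc
  obtain ⟨m, rfl⟩ : ∃ m, c = a + (Q + m) + 1 := ⟨c - a - 1 - Q, by omega⟩
  have hm : 0 < m := by omega
  have hW : window y (a + 1) (Q + m) = window x (a + 1) (Q + m) :=
    window_eq_iff.2 fun k hk => hagree _ (by omega) (by omega)
  have hW1 : window y (a + Q + 1) m = window x (a + 1 + Q) m :=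
    window_eq_iff.2 fun k hk => by
      rw [hagree _ (by omega) (by omega)]
      congr 1
      omega
  have hW2 : window y (a + 1) m = window x (a + 1 + Q) m :=
    window_eq_iff.2 fun k hk => by
      rw [hagree _ (by omega) (by omega), add_right_comm (a + 1), hxQ]
  have h1 := hy a (Q + m + 2)
  rw [window_add_two, hW] at h1
  have h2 := hxL a (Q + m + 2)
  rw [window_add_two] at h2
  have h3 := hy (a + Q) (m + 2)
  rw [window_add_two, hW1, hagree (a + Q) (by omega) (by omega), hxQ, add_assoc a Q m] at h3
  have h4 := hy a (m + 2)
  rw [window_add_two, hW2, hagree (a + m + 1) (by omega) (by omega), ← hxQ (a + m + 1),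
    show a + m + 1 + Q = a + (Q + m) + 1 by omega] at h4
  have key1 := hO _ _ _ _ _ h1 h2 hane hcne
  have key2 := hO _ _ _ _ _ h3 h4 hane.symm hcne
  have hdir : dirLT F r (window x (a + 1) (Q + m)) = dirLT F r (window x (a + 1 + Q) m) := by
    unfold dirLT
    rw [window_add, List.countP_append]
    simp [Nat.even_add, hxev (a + 1)]
  rw [hdir, ← key2] at key1
  rcases trichotomous_of rA (y a) (x a) with h | h | h
  · exact irrefl_of rA _ (trans_of rA h (key1.1 h))
  · exact hane h
  · exact irrefl_of rA _ (trans_of rA h (key1.2 h))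

end Periodic

/-! ### Positivity of invariant weights -/

section Positive

variable {A : Type*} [DecidableEq A] [Fintype A] {F : Finset A} {rA r : A → A → Prop}
  {μ : List A → ℝ} {L : Language A} [IsStrictTotalOrder A r]

/-- Each tail of a returning sequence with a prefix of weight zero occupies a single point of
`[0,1]`, and these points are moved by the isometries of the letters. -/
lemma exists_positions [IsStrictTotalOrder A rA] (hL : IsFactorialExtendable L)
    (hO : ∀ p, OrderConditionAt L p rA (dirLT F r p))
    (hμ : IsInvariantWeight μ) (hμL : ∀ w, μ w ≠ 0 → w ∈ L)
    {y : ℕ → A} (hy : ∀ i m, window y i m ∈ L)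
    (hret : ∀ n, ∃ j, 0 < j ∧ window y j n = window y 0 n) {n : ℕ}
    (hn : μ (window y 0 n) = 0) :
    ∃ t : ℕ → ℝ, (∀ i m, t i ∈ Icc (lowerEnd F r μ [] (window y i m))
        (lowerEnd F r μ [] (window y i m) + μ (window y i m))) ∧
      ∀ i, t (i + 1) = slide F rA r μ (y i) (t i) := by
  have hzero : ∀ i, ∃ M, ∀ k, μ (window y i (M + k)) = 0 := by
    intro i
    obtain ⟨j, hj, hjn⟩ := exists_return_ge hret n i
    obtain ⟨l, rfl⟩ := Nat.exists_eq_add_of_le hj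
    refine ⟨l + n, fun k => le_antisymm ?_ (hμ.nonneg _)⟩
    rw [window_add, window_add, hjn, ← hn]
    exact (hμ.append_right_le _ _).trans (hμ.append_left_le _ _)
  choose M hM using hzero
  let t : ℕ → ℝ := fun i => lowerEnd F r μ [] (window y i (M i))
  have ht : ∀ i k, lowerEnd F r μ [] (window y i (M i + k)) = t i := by
    intro i k
    have h := lowerEnd_append_mem (F := F) (r := r) hμ (window y i (M i)) (window y (i + M i) k)
    have h0 := hM i 0
    rw [← window_add, hM i k] at h
    rw [add_zero] at h0
    rw [h0] at h
    exact le_antisymm (by simpa using h.2) h.1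
  refine ⟨t, fun i m => ?_, fun i => ?_⟩
  · have h := lowerEnd_append_mem (F := F) (r := r) hμ (window y i m) (window y (i + m) (M i))
    rw [← window_add, add_comm m, ht, hM] at h
    exact ⟨h.1, by simpa using h.2⟩
  · have h1 := ht i (M (i + 1) + 1)
    have h1' := hM i (M (i + 1) + 1)
    have h2 := ht (i + 1) (M i)
    have h2' := hM (i + 1) (M i)
    rw [← add_assoc, window_succ] at h1 h1'
    rw [add_comm (M (i + 1))] at h2 h2'
    obtain ⟨δ, hδ, hδ', hs⟩ := exists_slide_eq (w := window y (i + 1) (M i + M (i + 1)))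
      hL hO hμ hμL (window_succ i _ ▸ hy i _)
    rw [h1', h2'] at hδ'
    rw [hs, h1, h1', h2]
    split_ifs <;> linarith

/-- The positions of the tails of a returning sequence with a prefix of weight zero are finitely
many. Away from the endpoints of the intervals of the letters, a position determines the letter,
hence the next position; and each occurrence of the prefix of weight zero is followed by a visit to
these endpoints, since otherwise it would coincide with a word of positive weight. -/
lemma finite_range_positions [IsStrictTotalOrder A rA] (hL : IsFactorialExtendable L)
    (hO : ∀ p, OrderConditionAt L p rA (dirLT F r p))
    (hμ : IsInvariantWeight μ) (hμL : ∀ w, μ w ≠ 0 → w ∈ L) {y : ℕ → A}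
    (hret : ∀ n, ∃ j, 0 < j ∧ window y j n = window y 0 n) {n : ℕ}
    (hn : μ (window y 0 n) = 0) {t : ℕ → ℝ}
    (ht : ∀ i m, t i ∈ Icc (lowerEnd F r μ [] (window y i m))
        (lowerEnd F r μ [] (window y i m) + μ (window y i m)))
    (hstep : ∀ i, t (i + 1) = slide F rA r μ (y i) (t i)) : (range t).Finite := by
  let D : Set ℝ := range (fun a : A => lowerEnd F r μ [] [a]) ∪
    range (fun a : A => lowerEnd F r μ [] [a] + μ [a])
  have hDfin : D.Finite := (finite_range _).union (finite_range _)
  have hIoo : ∀ {x : ℝ} {a : A}, x ∉ D →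
      x ∈ Icc (lowerEnd F r μ [] [a]) (lowerEnd F r μ [] [a] + μ [a]) →
      x ∈ Ioo (lowerEnd F r μ [] [a]) (lowerEnd F r μ [] [a] + μ [a]) := by
    intro x a hx hxa
    refine ⟨lt_of_le_of_ne hxa.1 fun h => hx (Or.inl ⟨a, h⟩),
      lt_of_le_of_ne hxa.2 fun h => hx (Or.inr ⟨a, h.symm⟩)⟩
  have hletter : ∀ {i a}, t i ∉ D →
      t i ∈ Icc (lowerEnd F r μ [] [a]) (lowerEnd F r μ [] [a] + μ [a]) → a = y i := by
    intro i a hi ha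
    have h1 : t i ∈ Icc (lowerEnd F r μ [] [y i]) (lowerEnd F r μ [] [y i] + μ [y i]) := ht i 1
    exact List.singleton_injective (eq_of_mem_Ioo_lowerEnd hμ rfl (hIoo hi ha) (hIoo hi h1))
  have hword : ∀ (u : List A) (i : ℕ), 0 < μ u →
      t i ∈ Icc (lowerEnd F r μ [] u) (lowerEnd F r μ [] u + μ u) →
      (∀ k < u.length, t (i + k) ∉ D) → u = window y i u.length := by
    intro u
    induction u with
    | nil => exact fun i _ _ _ => rfl
    | cons a u ih =>
      intro i hu hi hD
      have h1 := lowerEnd_append_mem (F := F) (r := r) hμ [a] u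
      have ha : a = y i := hletter (hD 0 (by simp)) ⟨h1.1.trans hi.1, hi.2.trans h1.2⟩
      have hu' : 0 < μ u := hu.trans_le (hμ.append_left_le [a] u)
      have hnext : t (i + 1) ∈ Icc (lowerEnd F r μ [] u) (lowerEnd F r μ [] u + μ u) := by
        rw [hstep, ← ha]
        exact slide_mem_Icc hL hO hμ hμL (hμL _ hu.ne') hi
      rw [List.length_cons, window_succ, ← ha, ← ih (i + 1) hu' hnext fun k hk => by
        rw [add_right_comm]
        exact hD (k + 1) (by simpa using hk)]
  refine finite_range_of_deterministic (D := D)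
    (hDfin.biUnion fun x _ => finite_range fun a : A => slide F rA r μ a x)
    (fun k hk => mem_biUnion hk ⟨y k, (hstep k).symm⟩) (fun N => ?_) fun i j hij hi => ?_
  · obtain ⟨j, hj, hjn⟩ := exists_return_ge hret n N
    have ht01 : t j ∈ Icc (0 : ℝ) 1 := by
      have h1 := lowerEnd_mem_unit (F := F) (r := r) hμ (window y j 0)
      exact ⟨h1.1.trans (ht j 0).1, (ht j 0).2.trans h1.2⟩
    obtain ⟨u, hul, hu, htu⟩ := exists_mem_Icc_lowerEnd (F := F) (r := r) hμ n ht01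
    by_contra hcon
    push Not at hcon
    have := hword u j hu htu fun k _ => hcon (j + k) (by omega)
    rw [this, hul, hjn, hn] at hu
    exact lt_irrefl _ hu
  · rw [hstep, hstep, ← hij, hletter (a := y j) hi (hij ▸ ht j 1)]

/-- A sequence whose factors have positive weight and closed intervals meeting a fixed finite set is
eventually periodic: a point is in the closed intervals of all the
prefixes of at most two sequences, one on each side. -/
lemma exists_period (hμ : IsInvariantWeight μ) {P : Set ℝ} (hP : P.Finite) {z : ℕ → A}
    (hz : ∀ i m, 0 < μ (window z i m))
    (hzP : ∀ i m, ∃ p ∈ P, p ∈ Icc (lowerEnd F r μ [] (window z i m))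
        (lowerEnd F r μ [] (window z i m) + μ (window z i m))) :
    ∃ j q, 0 < q ∧ ∀ k, z (j + k + q) = z (j + k) := by
  classical
  have := hP.to_subtype
  have hnest : ∀ j m k, lowerEnd F r μ [] (window z j m) ≤ lowerEnd F r μ [] (window z j (m + k)) ∧
      lowerEnd F r μ [] (window z j (m + k)) + μ (window z j (m + k)) ≤
        lowerEnd F r μ [] (window z j m) + μ (window z j m) := by
    intro j m k
    rw [window_add]
    exact lowerEnd_append_mem hμ _ _
  have hcommon : ∀ j, ∃ p : P, ∀ m, (p : ℝ) ∈ Icc (lowerEnd F r μ [] (window z j m))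
        (lowerEnd F r μ [] (window z j m) + μ (window z j m)) := by
    intro j
    choose p hpP hp using hzP j
    obtain ⟨x, hx⟩ := Finite.exists_infinite_fiber fun m => (⟨p m, hpP m⟩ : P)
    refine ⟨x, fun m => ?_⟩
    obtain ⟨m', hm', hmm'⟩ := (Set.infinite_coe_iff.1 hx).exists_gt m
    obtain ⟨k, rfl⟩ := Nat.exists_eq_add_of_le hmm'.le
    have hx' : p (m + k) = x := congrArg Subtype.val hm'
    have h1 := hp (m + k)
    rw [hx'] at h1
    exact ⟨(hnest j m k).1.trans h1.1, h1.2.trans (hnest j m k).2⟩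
  choose p hp using hcommon
  let side : ℕ → Prop := fun j =>
    ∀ m, (p j : ℝ) < lowerEnd F r μ [] (window z j m) + μ (window z j m)
  have hside : ∀ j, ¬ side j → ∀ m, lowerEnd F r μ [] (window z j m) < p j := by
    intro j hj m
    simp only [side] at hj
    push Not at hj
    obtain ⟨m₀, hm₀⟩ := hj
    have h1 := hnest j m₀ m
    have h2 := hnest j m m₀
    rw [add_comm m] at h2
    have h3 := hz j (m₀ + m)
    have h4 := (hp j (m₀ + m)).2
    linarith
  obtain ⟨j₁, j₂, hne, heq⟩ := Finite.exists_ne_map_eq_of_infinite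
    fun j => ((p j, decide (side j)) : P × Bool)
  have hpp : p j₁ = p j₂ := congrArg Prod.fst heq
  have hss : side j₁ ↔ side j₂ := by simpa using congrArg Prod.snd heq
  have hwin : ∀ m, window z j₁ m = window z j₂ m := by
    intro m
    have h1 := hp j₁ m
    have h2 := hp j₂ m
    rw [← hpp] at h2
    by_cases hs : side j₁
    · have h3 := hs m
      have h4 := hss.1 hs m
      rw [← hpp] at h4
      obtain ⟨x, hx1, hx2⟩ := exists_between (lt_min h3 h4)
      rw [lt_min_iff] at hx2
      exact eq_of_mem_Ioo_lowerEnd (F := F) (r := r) hμ (by simp) (t := x)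
        ⟨h1.1.trans_lt hx1, hx2.1⟩ ⟨h2.1.trans_lt hx1, hx2.2⟩
    · have h3 := hside j₁ hs m
      have h4 := hside j₂ (fun h => hs (hss.2 h)) m
      rw [← hpp] at h4
      obtain ⟨x, hx1, hx2⟩ := exists_between (max_lt h3 h4)
      rw [max_lt_iff] at hx1
      exact eq_of_mem_Ioo_lowerEnd (F := F) (r := r) hμ (by simp) (t := x)
        ⟨hx1.1, hx2.trans_le h1.2⟩ ⟨hx1.2, hx2.trans_le h2.2⟩
  have hzz : ∀ k, z (j₁ + k) = z (j₂ + k) := fun k =>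
    window_eq_iff.1 (hwin (k + 1)) k (Nat.lt_succ_self k)
  rcases lt_or_gt_of_ne hne with h | h
  · refine ⟨j₁, j₂ - j₁, by omega, fun k => ?_⟩
    rw [hzz k]
    congr 1
    omega
  · refine ⟨j₂, j₁ - j₂, by omega, fun k => ?_⟩
    rw [← hzz k]
    congr 1
    omega

omit [DecidableEq A] in
lemma IsInvariantWeight.exists_seq_pos (hμ : IsInvariantWeight μ) :
    ∃ z : ℕ → A, ∀ i m, 0 < μ (window z i m) := by
  choose b hb using fun w : {w // 0 < μ w} => hμ.exists_concat_pos w.2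
  let V : ℕ → {w // 0 < μ w} := fun k =>
    Nat.rec ⟨[], by simp [hμ.nil]⟩ (fun _ u => ⟨u.1 ++ [b u], hb u⟩) k
  have hlen : ∀ k, (V k).1.length = k := by
    intro k
    induction k with
    | zero => rfl
    | succ k ih =>
      change ((V k).1 ++ [b (V k)]).length = k + 1
      rw [List.length_append, ih, List.length_singleton]
  obtain ⟨z, hz⟩ := exists_window_eq (V := fun k => (V k).1) (fun k => ⟨_, rfl⟩)
    fun k => (hlen k).ge
  refine ⟨z, fun i m => ?_⟩
  have h := (V (i + m)).2
  rw [hz (i + m), hlen, window_add, zero_add] at h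
  exact h.trans_le (hμ.append_left_le _ _)

/-- An invariant weight carried by the factors of a returning sequence is positive on its
prefixes. -/
theorem pos_window_of_returning [IsStrictTotalOrder A rA] (hL : IsFactorialExtendable L)
    (hO : ∀ p, OrderConditionAt L p rA (dirLT F r p)) (hμ : IsInvariantWeight μ) {y : ℕ → A}
    (hy : ∀ i m, window y i m ∈ L) (hμy : ∀ w, μ w ≠ 0 → ∃ i, window y i w.length = w)
    (hret : ∀ n, ∃ j, 0 < j ∧ window y j n = window y 0 n) (n : ℕ) :
    0 < μ (window y 0 n) := by
  refine hμ.pos_of_ne_zero fun hn => ?_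
  have hμL : ∀ w, μ w ≠ 0 → w ∈ L := fun w hw => by
    obtain ⟨i, hi⟩ := hμy w hw
    exact hi ▸ hy i _
  obtain ⟨t, ht, hstep⟩ := exists_positions hL hO hμ hμL hy hret hn
  have hfin := finite_range_positions hL hO hμ hμL hret hn ht hstep
  obtain ⟨z, hz⟩ := hμ.exists_seq_pos
  have hzy : ∀ i m, ∃ j, window y j m = window z i m := fun i m => by
    simpa using hμy _ (hz i m).ne'
  obtain ⟨j, q, hq, hper⟩ := exists_period (F := F) (r := r) hμ hfin hz fun i m => by
    obtain ⟨k, hk⟩ := hzy i m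
    exact ⟨t k, mem_range_self k, hk ▸ ht k m⟩
  have hshift : ∀ i m, window (fun k => z (j + k)) i m = window z (j + i) m := fun i m =>
    window_eq_iff.2 fun k _ => by rw [add_assoc]
  refine not_periodic_of_returning hO hy hret hq (z := fun k => z (j + k)) (fun k => ?_)
    (fun i m => hshift i m ▸ hzy _ _) (n := n) fun i h => ?_
  · rw [← add_assoc, hper]
  · rw [hshift] at h
    exact (hz (j + i) n).ne' (h ▸ hn)

/-- A recurrent language with the order condition is the support of an invariant weight. -/
theorem exists_isInvariantWeight_support [IsStrictTotalOrder A rA] (hL : IsFactorialExtendable L)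
    (hrec : IsRecurrentLanguage L) (hO : ∀ p, OrderConditionAt L p rA (dirLT F r p)) :
    ∃ μ : List A → ℝ, IsInvariantWeight μ ∧ ∀ w, μ w ≠ 0 ↔ w ∈ L := by
  have hone : ∀ v : {v // v ∈ L}, ∃ μ : List A → ℝ, IsInvariantWeight μ ∧
      (∀ w, μ w ≠ 0 → w ∈ L) ∧ 0 < μ v := by
    rintro ⟨v, hv⟩
    obtain ⟨y, hy, hvy, hret⟩ := exists_returning_seq hL hrec hv
    obtain ⟨μ, hμ, hμy⟩ := exists_isInvariantWeight_of_seq y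
    refine ⟨μ, hμ, fun w hw => ?_, ?_⟩
    · obtain ⟨i, hi⟩ := hμy w hw
      exact hi ▸ hy i _
    · have := pos_window_of_returning hL hO hμ hy hμy hret v.length
      rwa [← hvy] at this
  choose ν hν hνL hνpos using hone
  have : Nonempty {v // v ∈ L} := ⟨⟨[], hL.nil_mem⟩⟩
  obtain ⟨e, he⟩ := exists_surjective_nat {v // v ∈ L}
  -- The weights adapted to the words of `L` are combined with the coefficients `1/2, 1/4, …`.
  have hle1 : ∀ v w, ν v w ≤ 1 := fun v w => (hν v).nil ▸ (hν v).append_right_le [] w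
  have hc : HasSum (fun k : ℕ => (1 : ℝ) / 2 / 2 ^ k) 1 := hasSum_geometric_two' 1
  have hsm : ∀ w, Summable fun k : ℕ => (1 : ℝ) / 2 / 2 ^ k * ν (e k) w := fun w =>
    Summable.of_nonneg_of_le (fun k => mul_nonneg (by positivity) ((hν _).nonneg w))
      (fun k => mul_le_of_le_one_right (by positivity) (hle1 _ w)) hc.summable
  refine ⟨fun w => ∑' k : ℕ, (1 : ℝ) / 2 / 2 ^ k * ν (e k) w,
    ⟨fun w => tsum_nonneg fun k => mul_nonneg (by positivity) ((hν _).nonneg w), ?_, ?_, ?_⟩, ?_⟩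
  · simp only [(hν _).nil, mul_one]
    exact hc.tsum_eq
  · intro w
    rw [← Summable.tsum_finsetSum fun a _ => hsm (a :: w)]
    simp only [← Finset.mul_sum, (hν _).sum_cons]
  · intro w
    rw [← Summable.tsum_finsetSum fun b _ => hsm (w ++ [b])]
    simp only [← Finset.mul_sum, (hν _).sum_concat]
  · intro w
    constructor
    · intro hw
      by_contra hwL
      refine hw ?_
      have : ∀ k, ν (e k) w = 0 := fun k => by
        by_contra h
        exact hwL (hνL _ w h)
      simp [this]
    · intro hw
      obtain ⟨k, hk⟩ := he ⟨w, hw⟩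
      refine ((hsm w).tsum_pos (fun k => mul_nonneg (by positivity) ((hν _).nonneg w)) k ?_).ne'
      rw [hk]
      exact mul_pos (by positivity) (hνpos ⟨w, hw⟩)

end Positive

/-! ### The equivalence -/

section Main

/-- The order condition, required at bispecial words only, extends to all words. -/
lemma FlippedOrderCondition.exists_dirLT {A : Type*} [DecidableEq A] {F : Finset A} {L : Language A}
    (hL : IsFactorialExtendable L) (h : FlippedOrderCondition F L) :
    ∃ rA r : A → A → Prop, IsStrictTotalOrder A rA ∧ IsStrictTotalOrder A r ∧
      ∀ p, OrderConditionAt L p rA (dirLT F r p) := by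
  obtain ⟨oA, oD, h⟩ := h
  refine ⟨oA.lt, oD.lt, letI := oA; inferInstance, letI := oD; inferInstance,
    fun p a b c d h1 h2 hab hcd => ?_⟩
  have hp : IsBispecial L p :=
    ⟨hL.init_mem p c (hL.tail_mem a _ h1),
      ⟨a, hL.init_mem (a :: p) c h1, b, hL.init_mem (b :: p) d h2, hab⟩,
      ⟨c, hL.tail_mem a _ h1, d, hL.tail_mem b _ h2, hcd⟩⟩
  unfold dirLT
  split_ifs with hev
  · exact (h p hp).1 hev a b c d h1 h2 hab hcd
  · exact (h p hp).2 (Nat.not_even_iff_odd.1 hev) a b c d h1 h2 hab hcd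

theorem theorem3p4 {A : Type*} [Fintype A] [DecidableEq A] (F : Finset A) (L : Language A)
    (hL : IsFactorialExtendable L) (hA : ∀ a : A, [a] ∈ L) :
    List.TFAE [
      FlippedOrderCondition F L ∧ IsRecurrentLanguage L,
      ∃ T : FlippedIET A F, T.IsStandard ∧ T.naturalCoding = L,
      ∃ T : FlippedIET A F, (¬ ∃ J : Set ℝ, T.IsWanderingInterval J) ∧ T.naturalCoding = L] := by
  tfae_have 1 → 2 := by
    rintro ⟨hord, hrec⟩
    obtain ⟨rA, r, _, _, hO⟩ := hord.exists_dirLT hL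
    obtain ⟨μ, hμ, hμL⟩ := exists_isInvariantWeight_support hL hrec hO
    exact exists_isStandard_of_weight hL hA hO hμ hμL
  tfae_have 2 → 3 := by
    rintro ⟨T, hT, hTL⟩
    exact ⟨T, hT.not_isWanderingInterval, hTL⟩
  tfae_have 3 → 1 := by
    rintro ⟨T, hT, rfl⟩
    exact ⟨T.flippedOrderCondition_naturalCoding, T.isRecurrentLanguage_naturalCoding hT⟩
  tfae_finish

end Main
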